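/- **Setting.** Let $T>0$. *Profile.* Let $V\in C^\infty([0,\infty))$ satisfy: $V(0)=0$, $V>0$ on $(0,\infty)$, $\lim_{x\to\infty}V(x)=1$, $\|V\|_{L^\infty([0,\infty))}=1$; $(-1)^{k+1}V^{(k)}>0$ on $[0,\infty)$ for all $k\ge 1$; $V^{(k)}\in L^\infty([0,\infty))$ for all $k\ge 0$; with $V_\varepsilon(x):=V(x/\varepsilon)$, $\sup_{\varepsilon>0}\|V_\varepsilon'\|_{L^\infty([c,\infty))}<\infty$ for all $c>0$; $-\infty<\inf_{y\ge 0}\frac{V''(y)}{V'(y)}\le v_{2,1}^+:=\sup_{y\ge0}\frac{V''(y)}{V'(y)}<0$; and $\lim_{x\to\infty}xV_\varepsilon^{(k)}(x)=0$ for all $k\ge1$, $\varepsilon>0$. *Data.* Let $q_0\in L^1(\mathbb R)$ be of bounded variation, $q_0\ge 0$ a.e., and suppose that for some $C\in\mathbb R$ one has $\frac{q_0(x)-q_0(y)}{x-y}\ge C$ for all $x\neq y$. Let $o\in W^{6,\infty}(\mathbb R)$ (continuous representative) with $o'\in W^{6,1}(\mathbb R)$, $\operatorname{ess\,inf}_{x}(o(x)-q_0(x))>0$,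 and such that $\lim_{x\to\pm\infty}o(x)$ exist in $\mathbb R$. *Viscosity approximation.* For $\nu,\varepsilon>0$ let $q_{\nu,\varepsilon}$ be a classical solution, in $C^3([0,T]\times\mathbb R)$ and with $q_{\nu,\varepsilon}(t,x)\to0$ and $\partial_xq_{\nu,\varepsilon}(t,x)\to0$ as $|x|\to\infty$ uniformly in $t\in[0,T]$ (solutions of class $H^5((0,T)\times\mathbb R)$ have these properties), of $$\partial_tq+\partial_x\big(V_\varepsilon(o-q)\,q\big)=\nu\,\partial_x^2(q-o)\ \text{ in }(0,T)\times\mathbb R,\qquad q(0,\cdot)=\varphi_\nu*q_0,$$ where $\varphi_\nu(x)=\nu^{-1}\varphi(x/\nu)$ and $\varphi$ is the standard mollifier, $\varphi(x)=c\,e^{1/(x^2-1)}$ for $|x|<1$, $\varphi(x)=0$ for $|x|\ge1$, $\int\varphi=1$. **Theorem (OSL condition for $V_\varepsilon(o-q_{\nu,\varepsilon})$ in space).** There is a function $\varepsilon\mapsto\nu(\varepsilon)>0$ on $(0,\infty)$ with $\lim_{\varepsilon\searrow0}\nu(\varepsilon)=0$ such that, for all $\varepsilon>0$, all $0<\nu\le\nu(\varepsilon)$,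 every such solution $q_{\nu,\varepsilon}$ and all $(t,x)\in(0,T)\times\mathbb R$, the derivative below exists and $$\partial_x\big(V_\varepsilon(o(x)-q_{\nu,\varepsilon}(t,x))\big)\le\max\Big\{C_1,\;C_2\sup_{\varepsilon>0}\|V_\varepsilon'\|_{L^\infty([k_0,\infty))},\;L_+\sup_{\varepsilon>0}\|V_\varepsilon'\|_{L^\infty([c_0,\infty))}\Big\},$$ where $k_0=\tfrac12\inf_{\mathbb R}o$, $c_0=\operatorname{ess\,inf}_{\mathbb R}(o-q_0)$, $v=\|V''/V'\|_{L^\infty([0,\infty))}$, $$C_1=\sqrt{\frac{(v+2\|V'\|_{L^\infty([0,\infty))})^2\|o'\|_{L^\infty(\mathbb R)}^2}{(v_{2,1}^+\inf_{\mathbb R} o)^2}+\frac{2\|V'\|_{L^\infty([0,\infty))}\big(-\|o''\|_{L^\infty(\mathbb R)}-1\big)}{v_{2,1}^+\inf_{\mathbb R} o}}-\frac{(v+2\|V'\|_{L^\infty([0,\infty))})\|o'\|_{L^\infty(\mathbb R)}}{v_{2,1}^+\inf_{\mathbb R} o},$$ $$C_2=T\|o''\|_{L^\infty(\mathbb R)}-\min\big\{-2\|o'\|_{L^\infty(\mathbb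 R)},\,L_-\big\}.$$ Here $L_-=\inf_{x\ne y}\frac{(q_0-o)(x)-(q_0-o)(y)}{x-y}$ and $L_+=\sup_{x\ne y}\frac{(o-q_0)(x)-(o-q_0)(y)}{x-y}$ are the one-sided Lipschitz bounds denoted $\operatorname{ess\,inf}(q_0'-o')$ and $\operatorname{ess\,sup}(o'-q_0')$. -/

import Mathlib

open MeasureTheory Set Filter Topology
open scoped ENNReal ContDiff

noncomputable section

namespace Obstacle

/-- `g` is the weak derivative of `f` on the real line. -/
def HasWeakDeriv (f g : ℝ → ℝ) : Prop :=
  LocallyIntegrable f volume ∧ LocallyIntegrable g volume ∧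
    ∀ φ : ℝ → ℝ, ContDiff ℝ ∞ φ → HasCompactSupport φ →
      ∫ x, f x * deriv φ x = - ∫ x, g x * φ x

/-- The Sobolev space `W^{k,p}(ℝ)`: `G i` is the `i`-th weak derivative of `f`. -/
def MemW (k : ℕ) (p : ℝ≥0∞) (f : ℝ → ℝ) : Prop :=
  ∃ G : ℕ → ℝ → ℝ, G 0 = f ∧ (∀ i ≤ k, MemLp (G i) p volume) ∧
    ∀ i < k, HasWeakDeriv (G i) (G (i + 1))

/-- The norm of `L^∞(S)` for `S ⊆ ℝ` with Lebesgue measure. -/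
def normLinf (S : Set ℝ) (f : ℝ → ℝ) : ℝ :=
  (eLpNorm f ∞ (volume.restrict S)).toReal

/-- The one-sided Lipschitz constant of `f` from below. For a function with such a constant this
is the essential infimum of `f'`. -/
def oslLower (f : ℝ → ℝ) : ℝ :=
  ⨅ p : {p : ℝ × ℝ // p.1 ≠ p.2}, (f p.1.1 - f p.1.2) / (p.1.1 - p.1.2)

/-- The one-sided Lipschitz constant of `f` from above, in the role of the essential supremum
of `f'`. -/
def oslUpper (f : ℝ → ℝ) : ℝ :=
  ⨆ p : {p : ℝ × ℝ // p.1 ≠ p.2}, (f p.1.1 - f p.1.2) / (p.1.1 - p.1.2)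

/-- The rescaled profile `V_ε(x) = V(x / ε)`. -/
def scaled (V : ℝ → ℝ) (ε : ℝ) (x : ℝ) : ℝ := V (x / ε)

/-- The `k`-th derivative of a function on `[0, ∞)` (one-sided at `0`); the values at negative
arguments play no role. -/
def dV (V : ℝ → ℝ) (k : ℕ) (x : ℝ) : ℝ := iteratedDerivWithin k V (Ici 0) x

/-- `sup_{ε > 0} ‖V_ε'‖_{L^∞[c, ∞)}`. -/
def supSlope (V : ℝ → ℝ) (c : ℝ) : ℝ :=
  ⨆ ε : Ioi (0 : ℝ), normLinf (Ici c) (dV (scaled V ε) 1)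

/-- `sup_{y ≥ 0} V''(y) / V'(y)`. -/
def vPlus (V : ℝ → ℝ) : ℝ := ⨆ y : Ici (0 : ℝ), dV V 2 y / dV V 1 y

/-- The assumptions on the profile `V` on `[0, ∞)` whose rescalings `V(· / ε)` approximate the
Heaviside function. -/
structure IsProfile (V : ℝ → ℝ) : Prop where
  smooth : ContDiffOn ℝ ∞ V (Ici 0)
  tendsto_one : Tendsto V atTop (𝓝 1)
  zero : V 0 = 0
  pos : ∀ x, 0 < x → 0 < V x
  sign : ∀ k : ℕ, 1 ≤ k → ∀ x, 0 ≤ x → 0 < (-1) ^ (k + 1) * dV V k x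
  memLinf : ∀ k : ℕ, MemLp (dV V k) ∞ (volume.restrict (Ici 0))
  norm_eq_one : normLinf (Ici 0) V = 1
  slope_bdd : ∀ c : ℝ, 0 < c →
    BddAbove (range fun ε : Ioi (0 : ℝ) => normLinf (Ici c) (dV (scaled V ε) 1))
  ratio_bddBelow : BddBelow (range fun y : Ici (0 : ℝ) => dV V 2 y / dV V 1 y)
  ratio_bddAbove : BddAbove (range fun y : Ici (0 : ℝ) => dV V 2 y / dV V 1 y)
  ratio_neg : vPlus V < 0
  decay : ∀ ε : ℝ, 0 < ε → ∀ k : ℕ, 1 ≤ k →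
    Tendsto (fun x => x * dV (scaled V ε) k x) atTop (𝓝 0)

/-- The assumptions on the obstacle `o` and the initial datum `q₀`. The obstacle is identified
with its continuous representative. -/
structure IsData (o q₀ : ℝ → ℝ) : Prop where
  init_integrable : Integrable q₀ volume
  init_bv : BoundedVariationOn q₀ univ
  init_nonneg : ∀ᵐ x, 0 ≤ q₀ x
  init_osl : ∃ C : ℝ, ∀ x y : ℝ, x ≠ y → C ≤ (q₀ x - q₀ y) / (x - y)
  obst_continuous : Continuous o
  obst_sobolev : MemW 6 ∞ o
  obst_deriv_sobolev : MemW 6 1 (deriv o)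
  gap : 0 < essInf (fun x => o x - q₀ x) volume
  obst_lim_top : ∃ l : ℝ, Tendsto o atTop (𝓝 l)
  obst_lim_bot : ∃ l : ℝ, Tendsto o atBot (𝓝 l)

/-- The unnormalised standard mollifier. -/
def bump (x : ℝ) : ℝ := if |x| < 1 then Real.exp (1 / (x ^ 2 - 1)) else 0

/-- The scaled standard mollifier `φ_ν(x) = ν⁻¹ φ(x / ν)`, where `φ` is `bump` divided by its
integral. -/
def mollifier (ν x : ℝ) : ℝ := ν⁻¹ * ((∫ y, bump y)⁻¹ * bump (x / ν))

/-- The convolution `φ_ν * f`. -/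
def mollify (ν : ℝ) (f : ℝ → ℝ) (x : ℝ) : ℝ := ∫ y, mollifier ν (x - y) * f y

/-- `q = q(t, x)` is a viscosity approximation: a classical solution, three times continuously
differentiable up to the boundary of `[0, T] × ℝ`, of
`∂ₜ q + ∂ₓ (V_ε(o - q) q) = ν ∂ₓ² (q - o)` on `(0, T) × ℝ`, with initial value `φ_ν * q₀`,
such that `q` and `∂ₓ q` tend to zero at spatial infinity, uniformly in time. The bound `q ≤ o`,
which keeps the argument of `V_ε` in `[0, ∞)`, is not required. -/
structure IsViscosityApprox (V o q₀ : ℝ → ℝ) (T ν ε : ℝ) (q : ℝ → ℝ → ℝ) : Prop where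
  regular : ContDiffOn ℝ 3 (fun z : ℝ × ℝ => q z.1 z.2) (Icc 0 T ×ˢ univ)
  vanish : ∀ δ : ℝ, 0 < δ → ∃ R : ℝ, ∀ t ∈ Icc 0 T, ∀ x : ℝ, R ≤ |x| →
    |q t x| ≤ δ ∧ |deriv (fun y => q t y) x| ≤ δ
  pde : ∀ t ∈ Ioo 0 T, ∀ x : ℝ,
    deriv (fun s => q s x) t + deriv (fun y => scaled V ε (o y - q t y) * q t y) x
      = ν * iteratedDeriv 2 (fun y => q t y - o y) x
  initial : ∀ x : ℝ, q 0 x = mollify ν q₀ x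

/-- The constant `v = ‖V'' / V'‖_{L^∞[0, ∞)}`. -/
def vNorm (V : ℝ → ℝ) : ℝ := normLinf (Ici 0) (fun y => dV V 2 y / dV V 1 y)

/-- The constant `k₀ = (inf o) / 2`. -/
def kZero (o : ℝ → ℝ) : ℝ := (⨅ y, o y) / 2

/-- The constant `c₀ = ess inf (o - q₀)`. -/
def cZero (o q₀ : ℝ → ℝ) : ℝ := essInf (fun y => o y - q₀ y) volume

/-- The constant `C₁`. -/
def constOne (V o : ℝ → ℝ) : ℝ :=
  √((vNorm V + 2 * normLinf (Ici 0) (dV V 1)) ^ 2 * normLinf univ (deriv o) ^ 2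
        / (vPlus V * ⨅ y, o y) ^ 2
      + 2 * normLinf (Ici 0) (dV V 1) * (-normLinf univ (iteratedDeriv 2 o) - 1)
        / (vPlus V * ⨅ y, o y))
    - (vNorm V + 2 * normLinf (Ici 0) (dV V 1)) * normLinf univ (deriv o)
        / (vPlus V * ⨅ y, o y)

/-- The constant `C₂`. -/
def constTwo (T : ℝ) (o q₀ : ℝ → ℝ) : ℝ :=
  T * normLinf univ (iteratedDeriv 2 o)
    - min (-2 * normLinf univ (deriv o)) (oslLower fun y => q₀ y - o y)

end Obstacle

end

/-! Write `u = o - q` for the distance to the obstacle, `z = ∂ₓ u`, and `w = V_ε'(u) z = ∂ₓ V_ε(u)`.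
The equation becomes `u_t = ∂ₓ(V_ε(u) (o - u)) + ν u_xx`, and the theorem is a maximum principle for
`w` fed by three cruder ones.

A decaying barrier shows `u > 0` (`IsFlow.pos`), and a growing one of size `ν` shows `q ≥ -O(ν)`
(`IsFlow.lower`). In the equation for `z` the term `-2 V_ε' z²` then dominates at large positive
`z`, so `z` grows at most linearly in time and stays below `C₂` (`IsFlow.slope_le`).

At a maximum of `w` there are two cases. If `u ≥ k₀`, then `w ≤ C₂ sup V_ε'` on `[k₀, ∞)`. If `u <
k₀`, then `q = o - u ≥ k₀`, and the concavity bound `V_ε'' ≤ (v_{2,1}^+ / ε) V_ε'` turns `V_ε' V_ε''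
z² q` into damping quadratic in `w`, while all other terms are at most linear in `w`. Every
coefficient carries the same factor `1/ε`, so the damping wins above an `ε`-independent root, which
is `C₁`. The viscous remainder is cubic in `z` and is made small by `ν`; it accounts for the `-1` in
`C₁` (`flux_slope_rate_le`, `IsFlow.flux_slope_le`).

The delicate point is the initial time: mollification perturbs `w`, and the bound `L_+ sup V_ε'` may
leave no room for an error. `initDist_dichotomy` supplies the room. Either the mollified slope is
below `L_+` by a definite amount, or the distance exceeds `c₀` by an amount of order `ν`; in the
second case the strict decrease of `V_ε'` gains at first order, while the symmetric mollifier loses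
only at second order (`eventually_initial_flux_slope_le`). -/

namespace Obstacle

/-! ### Weak derivatives and classical regularity of the obstacle -/

/-- A smooth compactly supported function of integral zero is the derivative of one. -/
theorem exists_testFunction_primitive {f : ℝ → ℝ} (hf : ContDiff ℝ ∞ f)
    (hc : HasCompactSupport f) (h0 : ∫ x, f x = 0) :
    ∃ φ : ℝ → ℝ, ContDiff ℝ ∞ φ ∧ HasCompactSupport φ ∧ deriv φ = f := by
  obtain ⟨R, hR⟩ := hc.isCompact.isBounded.subset_closedBall (0 : ℝ)
  have hz : ∀ x, R < |x| → f x = 0 := fun x hx => by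
    by_contra h
    have := hR (subset_tsupport f h)
    rw [Metric.mem_closedBall, dist_zero_right, Real.norm_eq_abs] at this
    linarith
  have hd : ∀ x, HasDerivAt (fun x => ∫ y in (-R)..x, f y) (f x) x := fun x =>
    hf.continuous.integral_hasStrictDerivAt _ x |>.hasDerivAt
  have hd' : deriv (fun x => ∫ y in (-R)..x, f y) = f := funext fun x => (hd x).deriv
  refine ⟨fun x => ∫ y in (-R)..x, f y, ?_, ?_, hd'⟩
  · rw [contDiff_infty_iff_deriv, hd']
    exact ⟨fun x => (hd x).differentiableAt, hf⟩
  · refine HasCompactSupport.intro (isCompact_Icc (a := -R) (b := R)) fun x hx => ?_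
    rcases lt_or_ge x (-R) with h | h
    · refine (intervalIntegral.integral_congr (g := fun _ => 0) fun y hy => ?_).trans (by simp)
      -- The support bound `hz` is strict, so the value at the endpoint `-R` has to come from
      -- continuity.
      by_cases hy' : y = -R
      · rw [uIcc_of_ge h.le] at hy
        subst hy'
        have : Tendsto f (𝓝[<] (-R)) (𝓝 (f (-R))) :=
          hf.continuous.continuousAt.mono_left nhdsWithin_le_nhds
        refine tendsto_nhds_unique this (tendsto_const_nhds.congr' ?_)
        filter_upwards [self_mem_nhdsWithin] with s hs
        refine (hz s ?_).symm
        have hs' : s < -R := hs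
        rw [lt_abs]; right; linarith
      · rw [uIcc_of_ge h.le] at hy
        apply hz
        rw [lt_abs]; right
        have := lt_of_le_of_ne hy.2 hy'
        linarith
    · have hx' : R < x := by
        by_contra h'
        exact hx ⟨h, not_lt.mp h'⟩
      change ∫ y in (-R)..x, f y = 0
      rw [intervalIntegral.integral_of_le h, ← h0]
      refine setIntegral_eq_integral_of_forall_compl_eq_zero fun y hy => ?_
      rcases lt_or_ge (-R) y with h1 | h1
      · apply hz
        have : x < y := by
          by_contra h'
          exact hy ⟨h1, not_lt.mp h'⟩
        exact (hx'.trans this).trans_le (le_abs_self y)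
      · rcases eq_or_lt_of_le h1 with rfl | h1
        · have : Tendsto f (𝓝[<] (-R)) (𝓝 (f (-R))) :=
            hf.continuous.continuousAt.mono_left nhdsWithin_le_nhds
          refine tendsto_nhds_unique this (tendsto_const_nhds.congr' ?_)
          filter_upwards [self_mem_nhdsWithin] with s hs
          refine (hz s ?_).symm
          have hs' : s < -R := hs
          rw [lt_abs]; right; linarith
        · apply hz
          rw [lt_abs]; right; linarith

/-- The lemma of du Bois-Reymond on the real line. -/
theorem ae_eq_const_of_integral_mul_deriv_eq_zero {h : ℝ → ℝ} (hh : LocallyIntegrable h volume)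
    (h0 : ∀ φ : ℝ → ℝ, ContDiff ℝ ∞ φ → HasCompactSupport φ → ∫ x, h x * deriv φ x = 0) :
    ∃ c, ∀ᵐ x, h x = c := by
  let b : ContDiffBump (0 : ℝ) := ⟨1, 2, one_pos, one_lt_two⟩
  set ψ : ℝ → ℝ := b.normed volume with hψ
  have hψs : ContDiff ℝ ∞ ψ := b.contDiff_normed
  have hψc : HasCompactSupport ψ := b.hasCompactSupport_normed
  have hint : ∀ η : ℝ → ℝ, Continuous η → HasCompactSupport η →
      Integrable (fun x => h x * η x) := fun η hη hηc => by
    simpa [mul_comm, smul_eq_mul] using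
      hh.integrable_smul_left_of_hasCompactSupport hη hηc
  refine ⟨∫ x, h x * ψ x, ?_⟩
  refine ae_eq_of_integral_contDiff_smul_eq hh (locallyIntegrable_const _) fun η hη hηc => ?_
  set I := ∫ x, η x with hI
  have hηi : Integrable η := hη.continuous.integrable_of_hasCompactSupport hηc
  have hψi : Integrable ψ := hψs.continuous.integrable_of_hasCompactSupport hψc
  -- Subtracting `I` times a bump of mass one makes the integral vanish, so the difference is an
  -- admissible `deriv φ`.
  obtain ⟨φ, hφ, hφc, hφd⟩ := exists_testFunction_primitive (f := fun x => η x - I * ψ x)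
    (hη.sub (contDiff_const.mul hψs))
    (hηc.sub (hψc.mul_left (f := fun _ => I)))
    (by
      rw [integral_sub hηi (hψi.const_mul I), integral_const_mul,
        show ∫ x, ψ x = 1 from b.integral_normed]
      simp [hI])
  have := h0 φ hφ hφc
  rw [hφd] at this
  have e : ∀ x, h x * (η x - I * ψ x) = h x * η x - I * (h x * ψ x) := fun x => by ring
  simp_rw [e] at this
  rw [integral_sub (hint η hη.continuous hηc) ((hint ψ hψs.continuous hψc).const_mul I),
    integral_const_mul] at this
  simp only [smul_eq_mul]
  rw [integral_mul_const, ← hI]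
  simp_rw [mul_comm (η _)]
  linarith

/-- A function with a weak derivative is almost everywhere a primitive of it. -/
theorem HasWeakDeriv.ae_eq_primitive {f g : ℝ → ℝ} (h : HasWeakDeriv f g) :
    ∃ c, ∀ᵐ x, f x = c + ∫ y in (0 : ℝ)..x, g y := by
  obtain ⟨hf, hg, hw⟩ := h
  have hgi : ∀ a b, IntervalIntegrable g volume a b := fun a b =>
    (hg.integrableOn_isCompact isCompact_uIcc).intervalIntegrable
  set F : ℝ → ℝ := fun x => ∫ y in (0 : ℝ)..x, g y with hF
  have hFc : Continuous F := intervalIntegral.continuous_primitive hgi 0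
  have hFl : LocallyIntegrable F volume := hFc.locallyIntegrable
  have hint : ∀ k : ℝ → ℝ, LocallyIntegrable k volume → ∀ η : ℝ → ℝ, Continuous η →
      HasCompactSupport η → Integrable (fun x => k x * η x) := fun k hk η hη hηc => by
    simpa [mul_comm, smul_eq_mul] using
      hk.integrable_smul_left_of_hasCompactSupport hη hηc
  obtain ⟨c, hc⟩ := ae_eq_const_of_integral_mul_deriv_eq_zero (h := fun x => f x - F x)
    (hf.sub hFl) (by
      intro φ hφ hφc
      have hφ1 : ContDiff ℝ 1 φ := hφ.of_le (by exact_mod_cast le_top)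
      have hφ' : Continuous (deriv φ) := hφ1.continuous_deriv le_rfl
      have hφ'c : HasCompactSupport (deriv φ) := hφc.deriv
      simp_rw [sub_mul]
      rw [integral_sub (hint f hf _ hφ' hφ'c) (hint F hFl _ hφ' hφ'c), hw φ hφ hφc]
      obtain ⟨R, hR⟩ := hφc.isCompact.isBounded.subset_closedBall (0 : ℝ)
      -- Strictly beyond the support and positive, so that no boundary terms arise when integrating
      -- by parts on `[-S, S]`.
      set S := max R 0 + 1 with hS
      have hRS : R < S := by have := le_max_left R 0; linarith
      have hS0 : 0 < S := by have := le_max_right R 0; linarith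
      have hz : ∀ x, S ≤ |x| → x ∉ tsupport φ := fun x hx hm => by
        have := hR hm
        rw [Metric.mem_closedBall, dist_zero_right, Real.norm_eq_abs] at this
        linarith
      have hz0 : ∀ x, S ≤ |x| → φ x = 0 := fun x hx => image_eq_zero_of_notMem_tsupport (hz x hx)
      have hz1 : ∀ x, S ≤ |x| → deriv φ x = 0 := fun x hx =>
        image_eq_zero_of_notMem_tsupport fun h => hz x hx (tsupport_deriv_subset (𝕜 := ℝ) h)
      have key : ∀ k : ℝ → ℝ, (∀ x, S ≤ |x| → k x = 0) → ∫ x, k x = ∫ x in (-S)..S, k x := by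
        intro k hk
        rw [intervalIntegral.integral_of_le (by linarith)]
        refine (setIntegral_eq_integral_of_forall_compl_eq_zero fun y hy => hk y ?_).symm
        by_contra h'
        rw [not_le, abs_lt] at h'
        exact hy ⟨h'.1, h'.2.le⟩
      rw [key _ fun x hx => by rw [hz0 x hx, mul_zero], key _ fun x hx => by rw [hz1 x hx, mul_zero]]
      have hFac : AbsolutelyContinuousOnInterval F (-S) S :=
        (hgi (-S) S).absolutelyContinuousOnInterval_intervalIntegral
          (by rw [uIcc_of_le (by linarith)]; constructor <;> linarith)
      rw [hFac.integral_mul_deriv_eq_deriv_mul hφ1.contDiffOn.absolutelyContinuousOnInterval,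
        hz0 S (le_abs_self S), hz0 (-S) (by rw [abs_neg]; exact le_abs_self S)]
      have : ∫ x in (-S)..S, deriv F x * φ x = ∫ x in (-S)..S, g x * φ x := by
        apply intervalIntegral.integral_congr_ae
        filter_upwards [LocallyIntegrable.ae_hasDerivAt_integral hg] with x hx _
        rw [(hx 0).deriv]
      rw [this]; ring)
  exact ⟨c, hc.mono fun x hx => by linarith⟩

theorem eq_of_ae_eq_of_continuous {f g : ℝ → ℝ} (hf : Continuous f) (hg : Continuous g)
    (h : ∀ᵐ x, f x = g x) : f = g :=
  (Continuous.ae_eq_iff_eq volume hf hg).1 h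

/-- A continuous function with a weak derivative that is itself weakly differentiable is
continuously differentiable. -/
theorem exists_hasDerivAt_of_hasWeakDeriv {f G₀ G₁ G₂ : ℝ → ℝ} (hf : Continuous f)
    (h0 : ∀ᵐ x, f x = G₀ x) (h1 : HasWeakDeriv G₀ G₁) (h2 : HasWeakDeriv G₁ G₂) :
    ∃ g : ℝ → ℝ, Continuous g ∧ (∀ᵐ x, g x = G₁ x) ∧ ∀ x, HasDerivAt f (g x) x := by
  obtain ⟨c₁, hc₁⟩ := h1.ae_eq_primitive
  obtain ⟨c₂, hc₂⟩ := h2.ae_eq_primitive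
  have hi : ∀ a b, IntervalIntegrable G₂ volume a b := fun a b =>
    (h2.2.1.integrableOn_isCompact isCompact_uIcc).intervalIntegrable
  -- The continuous representative of `G₁`; being a primitive of a continuous function, `f` is then
  -- differentiable everywhere.
  set g : ℝ → ℝ := fun x => c₂ + ∫ y in (0 : ℝ)..x, G₂ y
  have hg : Continuous g := continuous_const.add (intervalIntegral.continuous_primitive hi 0)
  refine ⟨g, hg, hc₂.mono fun x hx => hx.symm, ?_⟩
  have hd : ∀ x, HasDerivAt (fun x => c₁ + ∫ y in (0 : ℝ)..x, g y) (g x) x := fun x =>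
    (hg.integral_hasStrictDerivAt 0 x).hasDerivAt.const_add c₁
  have hfe : f = fun x => c₁ + ∫ y in (0 : ℝ)..x, g y := by
    refine eq_of_ae_eq_of_continuous hf
      (continuous_iff_continuousAt.2 fun x => (hd x).continuousAt) ?_
    filter_upwards [h0, hc₁] with x hx hx'
    rw [hx, hx']
    congr 1
    exact intervalIntegral.integral_congr_ae (hc₂.mono fun y hy _ => hy)
  intro x
  rw [hfe]
  exact hd x

/-- The set where the essential bound holds is closed by continuity and dense because it has full
measure. -/
theorem abs_le_normLinf_univ {f : ℝ → ℝ} (hf : Continuous f) (hm : MemLp f ∞ volume) (x : ℝ) :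
    |f x| ≤ normLinf univ f := by
  have h : ∀ᵐ y, f y ∈ Metric.closedBall (0 : ℝ) (normLinf univ f) := by
    have := ae_le_eLpNormEssSup (f := f) (μ := volume)
    filter_upwards [this] with y hy
    rw [mem_closedBall_zero_iff, normLinf, Measure.restrict_univ, eLpNorm_exponent_top]
    have hfin : eLpNormEssSup f volume ≠ ⊤ := by
      simpa [eLpNorm_exponent_top] using hm.eLpNorm_ne_top
    have := (ENNReal.toReal_le_toReal (by simp) hfin).2 hy
    simpa using this
  have hcl : IsClosed (f ⁻¹' Metric.closedBall (0 : ℝ) (normLinf univ f)) :=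
    Metric.isClosed_closedBall.preimage hf
  have hdense : Dense (f ⁻¹' Metric.closedBall (0 : ℝ) (normLinf univ f)) :=
    Measure.dense_of_ae h
  have := hcl.closure_eq ▸ hdense x
  simpa using this

/-- The obstacle has three continuous bounded derivatives. -/
theorem exists_derivs_of_memW {o : ℝ → ℝ} (ho : Continuous o) (hW : MemW 6 ∞ o) :
    ∃ o1 o2 o3 : ℝ → ℝ, (∀ x, HasDerivAt o (o1 x) x) ∧ (∀ x, HasDerivAt o1 (o2 x) x) ∧
      (∀ x, HasDerivAt o2 (o3 x) x) ∧ Continuous o3 ∧ (∃ K, ∀ x, |o x| ≤ K) ∧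
      (∀ x, |o1 x| ≤ normLinf univ (deriv o)) ∧
      (∀ x, |o2 x| ≤ normLinf univ (iteratedDeriv 2 o)) ∧ ∃ K, ∀ x, |o3 x| ≤ K := by
  obtain ⟨G, hG0, hGm, hGd⟩ := hW
  obtain ⟨o1, c1, e1, d1⟩ := exists_hasDerivAt_of_hasWeakDeriv ho
    (Eventually.of_forall fun x => by rw [hG0]) (hGd 0 (by norm_num)) (hGd 1 (by norm_num))
  obtain ⟨o2, c2, e2, d2⟩ := exists_hasDerivAt_of_hasWeakDeriv c1 e1
    (hGd 1 (by norm_num)) (hGd 2 (by norm_num))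
  obtain ⟨o3, c3, e3, d3⟩ := exists_hasDerivAt_of_hasWeakDeriv c2 e2
    (hGd 2 (by norm_num)) (hGd 3 (by norm_num))
  have E1 : deriv o = o1 := funext fun x => (d1 x).deriv
  have E2 : iteratedDeriv 2 o = o2 := by
    rw [iteratedDeriv_succ, iteratedDeriv_one, E1]
    exact funext fun x => (d2 x).deriv
  refine ⟨o1, o2, o3, d1, d2, d3, c3, ⟨normLinf univ o, ?_⟩, ?_, ?_, ⟨normLinf univ o3, ?_⟩⟩
  · exact abs_le_normLinf_univ ho (hG0 ▸ hGm 0 (by norm_num))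
  · rw [E1]
    exact abs_le_normLinf_univ c1 ((memLp_congr_ae e1).2 (hGm 1 (by norm_num)))
  · rw [E2]
    exact abs_le_normLinf_univ c2 ((memLp_congr_ae e2).2 (hGm 2 (by norm_num)))
  · exact abs_le_normLinf_univ c3 ((memLp_congr_ae e3).2 (hGm 3 (by norm_num)))

/-! ### Maximum principle on the line -/

/-- A function that is negative initially and far away stays negative as long as it cannot touch
zero for the first time. -/
theorem neg_of_no_first_touch {F : ℝ → ℝ → ℝ} {T : ℝ}
    (hc : ContinuousOn (fun p : ℝ × ℝ => F p.1 p.2) (Ico 0 T ×ˢ univ))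
    (h0 : ∀ x, F 0 x < 0) (hfar : ∃ R, ∀ t ∈ Ico 0 T, ∀ x, R ≤ |x| → F t x < 0)
    (htouch : ∀ t ∈ Ioo 0 T, ∀ x, F t x = 0 → (∀ s ∈ Ico 0 t, F s x < 0) →
      (∀ y, F t y ≤ 0) → False) :
    ∀ t ∈ Ico 0 T, ∀ x, F t x < 0 := by
  intro t₁ ht₁ x₁
  by_contra hneg
  rw [not_lt] at hneg
  obtain ⟨R, hR⟩ := hfar
  have hin : ∀ t ∈ Ico 0 T, ∀ x, 0 ≤ F t x → x ∈ Icc (-R) R := fun t ht x hx => by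
    by_contra h
    refine absurd (hR t ht x ?_) (not_lt.2 hx)
    by_contra h'
    rw [not_le, abs_lt] at h'
    exact h ⟨h'.1.le, h'.2.le⟩
  set K : Set (ℝ × ℝ) := Icc 0 t₁ ×ˢ Icc (-R) R with hK
  have hKs : K ⊆ Ico 0 T ×ˢ univ := fun p hp =>
    ⟨⟨hp.1.1, hp.1.2.trans_lt ht₁.2⟩, mem_univ _⟩
  have hKc : IsCompact K := isCompact_Icc.prod isCompact_Icc
  have hA : IsCompact (K ∩ (fun p : ℝ × ℝ => F p.1 p.2) ⁻¹' Ici 0) :=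
    hKc.of_isClosed_subset ((hc.mono hKs).preimage_isClosed_of_isClosed hKc.isClosed isClosed_Ici)
      inter_subset_left
  -- The first touching point is a point of least time in the set `F ≥ 0`, which is compact because
  -- the far-field bound confines it in space.
  obtain ⟨⟨t, x⟩, ⟨hpK, hp0⟩, hmin⟩ := hA.exists_isMinOn
    ⟨(t₁, x₁), ⟨⟨⟨ht₁.1, le_rfl⟩, hin t₁ ht₁ x₁ hneg⟩, hneg⟩⟩ continuous_fst.continuousOn
  have hp0' : 0 ≤ F t x := hp0
  have htT : t ∈ Ico 0 T := ⟨hpK.1.1, hpK.1.2.trans_lt ht₁.2⟩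
  have htpos : 0 < t := by
    rcases eq_or_lt_of_le htT.1 with h | h
    · subst h
      exact absurd (h0 x) (not_lt.2 hp0')
    · exact h
  have hbefore : ∀ s ∈ Ico 0 t, ∀ y, F s y < 0 := fun s hs y => by
    by_contra h
    rw [not_lt] at h
    have := hmin (show (s, y) ∈ _ from
      ⟨⟨⟨hs.1, hs.2.le.trans hpK.1.2⟩, hin s ⟨hs.1, hs.2.trans htT.2⟩ y h⟩, h⟩)
    exact absurd hs.2 (not_lt.2 this)
  have hle : ∀ y, F t y ≤ 0 := fun y => by
    have hcy : ContinuousWithinAt (fun s => F s y) (Ico 0 T) t := by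
      have h2 : ContinuousWithinAt (fun s : ℝ => (s, y)) (Ico 0 T) t :=
        (by fun_prop : Continuous fun s : ℝ => (s, y)).continuousWithinAt
      exact ContinuousWithinAt.comp (f := fun s : ℝ => (s, y)) (x := t)
        (hc (t, y) ⟨htT, mem_univ _⟩) h2 fun s hs => ⟨hs, mem_univ _⟩
    have : (𝓝[Ico 0 t] t).NeBot := by
      rw [← mem_closure_iff_nhdsWithin_neBot, closure_Ico htpos.ne]
      exact ⟨htpos.le, le_rfl⟩
    refine le_of_tendsto (hcy.mono (s := Ico 0 t)
      fun s hs => ⟨hs.1, hs.2.trans htT.2⟩) ?_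
    filter_upwards [self_mem_nhdsWithin] with s hs using (hbefore s hs y).le
  exact htouch t ⟨htpos, htT.2⟩ x (le_antisymm (hle x) hp0') (fun s hs => hbefore s hs x) hle

/-- The second derivative is nonpositive at a maximum. -/
theorem second_deriv_nonpos_of_isMax {f f' : ℝ → ℝ} {f'' x : ℝ}
    (h1 : ∀ y, HasDerivAt f (f' y) y) (h2 : HasDerivAt f' f'' x) (hmax : ∀ y, f y ≤ f x) :
    f' x = 0 ∧ f'' ≤ 0 := by
  have hlm : IsLocalMax f x := Eventually.of_forall hmax
  have h0 : f' x = 0 := hlm.hasDerivAt_eq_zero (h1 x)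
  refine ⟨h0, ?_⟩
  -- A positive second derivative would make `x` a local minimum as well; then `f` is locally
  -- constant and the second derivative is zero.
  by_contra hpos
  rw [not_le] at hpos
  have hd : deriv f = f' := funext fun y => (h1 y).deriv
  have hmin : IsLocalMin f x := isLocalMin_of_deriv_deriv_pos (by rw [hd, h2.deriv]; exact hpos)
    (by rw [hd, h0]) (h1 x).continuousAt
  have hconst : f =ᶠ[𝓝 x] fun _ => f x :=
    hmin.mono fun y hy => le_antisymm (hmax y) hy
  have h3 : f' =ᶠ[𝓝 x] fun _ => 0 := by
    have := hconst.deriv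
    rw [hd] at this
    simpa using this
  have h4 := h2.unique ((hasDerivAt_const x (0 : ℝ)).congr_of_eventuallyEq h3)
  linarith

/-- Difference quotients from the left have negative numerator and negative denominator. -/
theorem deriv_nonneg_of_first_zero {f : ℝ → ℝ} {f' t : ℝ} (ht : 0 < t) (hd : HasDerivAt f f' t)
    (h0 : f t = 0) (hneg : ∀ s ∈ Ico 0 t, f s < 0) : 0 ≤ f' := by
  have h := (hasDerivWithinAt_iff_tendsto_slope' (by simp)).1
    (hd.hasDerivWithinAt (s := Iio t))
  refine ge_of_tendsto h ?_
  filter_upwards [Ioo_mem_nhdsLT ht] with s hs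
  rw [slope_def_field, h0, sub_zero]
  exact div_nonneg_of_nonpos (hneg s ⟨hs.1.le, hs.2⟩).le (by linarith [hs.2])

/-- Weak maximum principle in the form used below. -/
theorem neg_of_maximum_principle {F Fx Fxx Ft : ℝ → ℝ → ℝ} {T : ℝ}
    (hc : ContinuousOn (fun p : ℝ × ℝ => F p.1 p.2) (Ico 0 T ×ˢ univ))
    (h0 : ∀ x, F 0 x < 0) (hfar : ∃ R, ∀ t ∈ Ico 0 T, ∀ x, R ≤ |x| → F t x < 0)
    (hx : ∀ t ∈ Ioo 0 T, ∀ x, HasDerivAt (F t) (Fx t x) x)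
    (hxx : ∀ t ∈ Ioo 0 T, ∀ x, HasDerivAt (Fx t) (Fxx t x) x)
    (ht : ∀ t ∈ Ioo 0 T, ∀ x, HasDerivAt (fun s => F s x) (Ft t x) t)
    (htouch : ∀ t ∈ Ioo 0 T, ∀ x, F t x = 0 → Fx t x = 0 → Fxx t x ≤ 0 → 0 ≤ Ft t x → False) :
    ∀ t ∈ Ico 0 T, ∀ x, F t x < 0 := by
  refine neg_of_no_first_touch hc h0 hfar fun t htt x hF hb hm => ?_
  obtain ⟨h1, h2⟩ := second_deriv_nonpos_of_isMax (hx t htt) (hxx t htt x)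
    fun y => (hm y).trans hF.ge
  exact htouch t htt x hF h1 h2 (deriv_nonneg_of_first_zero htt.1 (ht t htt x) hF hb)

/-! ### A priori estimates for the distance to the obstacle -/

/-- The pointwise properties of a concave saturating velocity `f₀` and its first three
derivatives on `(0, ∞)`. -/
structure IsFlux (f0 f1 f2 f3 : ℝ → ℝ) (g v : ℝ) : Prop where
  d0 : ∀ y, 0 < y → HasDerivAt f0 (f1 y) y
  d1 : ∀ y, 0 < y → HasDerivAt f1 (f2 y) y
  d2 : ∀ y, 0 < y → HasDerivAt f2 (f3 y) y
  pos0 : ∀ y, 0 < y → 0 < f0 y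
  le_one : ∀ y, 0 < y → f0 y ≤ 1
  pos1 : ∀ y, 0 < y → 0 < f1 y
  neg2 : ∀ y, 0 < y → f2 y < 0
  pos3 : ∀ y, 0 < y → 0 < f3 y
  le_slope : ∀ y, 0 < y → f1 y ≤ g
  le_linear : ∀ y, 0 < y → f0 y ≤ g * y
  ratio : ∀ y, 0 < y → -f2 y ≤ v * f1 y

/-- The distance `u = o - q` of the solution to the obstacle, with its derivatives
`z = ∂ₓ u`, `zx`, `zxx`, `ut = ∂ₜ u`, `zt = ∂ₜ z = ∂ₓ ut`. -/
structure IsFlow (T ν : ℝ) (f0 f1 o o1 : ℝ → ℝ) (u z zx zxx ut zt : ℝ → ℝ → ℝ) : Prop where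
  cont_u : ContinuousOn (fun p : ℝ × ℝ => u p.1 p.2) (Ico 0 T ×ˢ univ)
  cont_z : ContinuousOn (fun p : ℝ × ℝ => z p.1 p.2) (Ico 0 T ×ˢ univ)
  d_u : ∀ t ∈ Ico 0 T, ∀ x, HasDerivAt (u t) (z t x) x
  d_z : ∀ t ∈ Ioo 0 T, ∀ x, HasDerivAt (z t) (zx t x) x
  d_zx : ∀ t ∈ Ioo 0 T, ∀ x, HasDerivAt (zx t) (zxx t x) x
  dt_u : ∀ t ∈ Ioo 0 T, ∀ x, HasDerivAt (fun s => u s x) (ut t x) t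
  dt_z : ∀ t ∈ Ioo 0 T, ∀ x, HasDerivAt (fun s => z s x) (zt t x) t
  d_ut : ∀ t ∈ Ioo 0 T, ∀ x, HasDerivAt (ut t) (zt t x) x
  pde : ∀ t ∈ Ioo 0 T, ∀ x, 0 < u t x →
    ut t x = f1 (u t x) * z t x * (o x - u t x) + f0 (u t x) * (o1 x - z t x) + ν * zx t x
  vanish : ∀ δ, 0 < δ → ∃ R : ℝ, ∀ t ∈ Ico 0 T, ∀ x, R ≤ |x| →
    |o x - u t x| ≤ δ ∧ |o1 x - z t x| ≤ δ

/-- The pointwise estimate of `∂ₜ w` for `w = f₁(u) z` at a spatial maximum of `w`. -/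
theorem flux_slope_rate_le {α k ν g v N1 N2 F0 F1 F2 F3 Z0 Z1 Z2 Z a1 a2 Q : ℝ}
    (hν : 0 ≤ ν) (hα0 : 0 ≤ α) (hk : 0 ≤ k) (hN2 : 0 ≤ N2)
    (e0 : 0 ≤ F0) (e0' : F0 ≤ 1) (e1 : 0 < F1) (e1' : F1 ≤ g) (e2 : F2 < 0) (e3 : 0 < F3)
    (e4 : -F2 ≤ v * F1) (e5 : F2 ≤ -α * F1) (e6 : |a1| ≤ N1) (e7 : a2 ≤ N2)
    (hZ0 : 0 < Z0) (hzZ : Z0 ≤ Z) (hQk : k ≤ Q) (hνZ : 2 * ν * v ^ 2 * Z ^ 3 ≤ 1)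
    (h2 : F2 * Z0 * Z0 + F1 * Z1 = 0)
    (h3 : (F3 * Z0 * Z0 + F2 * Z1) * Z0 + F2 * Z0 * Z1 + (F2 * Z0 * Z1 + F1 * Z2) ≤ 0) :
    F2 * (F1 * Z0 * Q + F0 * (a1 - Z0) + ν * Z1) * Z0 +
      F1 * (F2 * Z0 ^ 2 * Q + F1 * Z1 * Q + 2 * F1 * Z0 * (a1 - Z0) + F0 * (a2 - Z1) + ν * Z2)
      ≤ -(α * k * (F1 * Z0) ^ 2 - (2 * g + v) * N1 * (F1 * Z0) - (g * N2 + g)) := by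
  have hN0 : 0 ≤ N1 := (abs_nonneg _).trans e6
  have e6' := abs_le.1 e6
  have hg0 : 0 ≤ g := e1.le.trans e1'
  have hx : F1 * Z1 = -(F2 * Z0 * Z0) := by linarith
  -- The criticality relation `h2`, which is `∂ₓ w = 0`, removes the transport terms in `Z1`.
  have h5 : F2 * (F1 * Z0 * Q + F0 * (a1 - Z0) + ν * Z1) * Z0 +
      F1 * (F2 * Z0 ^ 2 * Q + F1 * Z1 * Q + 2 * F1 * Z0 * (a1 - Z0) + F0 * (a2 - Z1) + ν * Z2)
      = F1 * F2 * Z0 ^ 2 * Q + F2 * Z0 * F0 * a1 + 2 * F1 ^ 2 * Z0 * (a1 - Z0)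
        + F1 * F0 * a2 + ν * (F2 * Z0 * Z1 + F1 * Z2) := by
    linear_combination (F1 * Q - F0) * h2
  -- The damping: strict concavity, through `α`, together with `Q ≥ k`. This is the only term
  -- quadratic in `w = F1 * Z0`.
  have t1 : F1 * F2 * Z0 ^ 2 * Q ≤ -(α * k * (F1 * Z0) ^ 2) := by
    have b1 : F2 * Q ≤ -α * F1 * Q := mul_le_mul_of_nonneg_right e5 (by linarith)
    have b2 : α * F1 * k ≤ α * F1 * Q := mul_le_mul_of_nonneg_left hQk (by positivity)
    have b3 : F1 * Z0 ^ 2 * (F2 * Q) ≤ F1 * Z0 ^ 2 * (-(α * F1 * k)) :=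
      mul_le_mul_of_nonneg_left (by linarith) (by positivity)
    calc _ = F1 * Z0 ^ 2 * (F2 * Q) := by ring
      _ ≤ _ := b3
      _ = _ := by ring
  have t2 : F2 * Z0 * F0 * a1 ≤ v * N1 * (F1 * Z0) := by
    have b1 : F0 * (-a1) ≤ N1 := by nlinarith
    have b2 : (-F2) * Z0 * (F0 * (-a1)) ≤ (-F2) * Z0 * N1 :=
      mul_le_mul_of_nonneg_left b1 (mul_nonneg (by linarith) hZ0.le)
    have b3 : (-F2) * (Z0 * N1) ≤ v * F1 * (Z0 * N1) :=
      mul_le_mul_of_nonneg_right e4 (by positivity)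
    calc _ = (-F2) * Z0 * (F0 * (-a1)) := by ring
      _ ≤ (-F2) * (Z0 * N1) := by linarith
      _ ≤ _ := b3
      _ = _ := by ring
  have t3 : 2 * F1 ^ 2 * Z0 * (a1 - Z0) ≤ 2 * g * N1 * (F1 * Z0) := by
    have b0 : F1 * (a1 - Z0) ≤ F1 * N1 := mul_le_mul_of_nonneg_left (by linarith) e1.le
    have b1 : F1 * N1 ≤ g * N1 := mul_le_mul_of_nonneg_right e1' hN0
    have b2 : 2 * (F1 * Z0) * (F1 * (a1 - Z0)) ≤ 2 * (F1 * Z0) * (g * N1) :=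
      mul_le_mul_of_nonneg_left (b0.trans b1) (by positivity)
    calc _ = 2 * (F1 * Z0) * (F1 * (a1 - Z0)) := by ring
      _ ≤ _ := b2
      _ = _ := by ring
  have t4 : F1 * F0 * a2 ≤ g * N2 := by
    have b1 : F1 * F0 ≤ g * 1 := mul_le_mul e1' e0' e0 hg0
    rw [mul_one] at b1
    exact (mul_le_mul_of_nonneg_left e7 (by positivity)).trans
      (mul_le_mul_of_nonneg_right b1 hN2)
  -- With `F3 > 0`, the inequality `h3` (`∂ₓ² w ≤ 0`) bounds the viscous bracket by `-2 F2 Z0 Z1`.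
  -- By `h2` this is `2 F2² Z0³ / F1 ≤ 2 v² F1 Z0³`, and `hνZ` makes its product with `ν` at most
  -- `F1 ≤ g`.
  have t5 : ν * (F2 * Z0 * Z1 + F1 * Z2) ≤ g := by
    have b1 : F2 * Z0 * Z1 + F1 * Z2 ≤ -2 * (F2 * Z0 * Z1) := by
      have : 0 ≤ F3 * Z0 * Z0 * Z0 := by positivity
      linarith
    have b2 : -(F2 * Z0 * Z1) ≤ v ^ 2 * F1 * Z0 ^ 3 := by
      have c1 : F1 * (-(F2 * Z0 * Z1)) = F2 ^ 2 * Z0 ^ 3 := by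
        linear_combination -(F2 * Z0) * hx
      have c2 : F2 ^ 2 ≤ (v * F1) ^ 2 := by
        have := pow_le_pow_left₀ (neg_nonneg.2 e2.le) e4 2
        rwa [neg_sq] at this
      have c3 : F2 ^ 2 * Z0 ^ 3 ≤ (v * F1) ^ 2 * Z0 ^ 3 :=
        mul_le_mul_of_nonneg_right c2 (by positivity)
      refine le_of_mul_le_mul_left ?_ e1
      calc _ = F2 ^ 2 * Z0 ^ 3 := c1
        _ ≤ _ := c3
        _ = _ := by ring
    have b3 : Z0 ^ 3 ≤ Z ^ 3 := pow_le_pow_left₀ hZ0.le hzZ 3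
    have b4 : ν * (F2 * Z0 * Z1 + F1 * Z2) ≤ ν * (2 * (v ^ 2 * F1 * Z0 ^ 3)) :=
      mul_le_mul_of_nonneg_left (by linarith) hν
    have b5 : 2 * ν * v ^ 2 * Z0 ^ 3 ≤ 1 :=
      (mul_le_mul_of_nonneg_left b3 (by positivity)).trans hνZ
    have b6 : ν * (2 * (v ^ 2 * F1 * Z0 ^ 3)) = F1 * (2 * ν * v ^ 2 * Z0 ^ 3) := by ring
    have b7 : F1 * (2 * ν * v ^ 2 * Z0 ^ 3) ≤ F1 * 1 := mul_le_mul_of_nonneg_left b5 e1.le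
    linarith
  rw [h5]
  linarith

section Flow

variable {T ν g v N1 N2 : ℝ} {f0 f1 f2 f3 o o1 o2 : ℝ → ℝ} {u z zx zxx ut zt : ℝ → ℝ → ℝ}

/-- The equation for the spatial derivative. -/
theorem IsFlow.eq_zt (hF : IsFlux f0 f1 f2 f3 g v) (h : IsFlow T ν f0 f1 o o1 u z zx zxx ut zt)
    (ho : ∀ x, HasDerivAt o (o1 x) x) (ho1 : ∀ x, HasDerivAt o1 (o2 x) x)
    {t : ℝ} (ht : t ∈ Ioo 0 T) (hpos : ∀ x, 0 < u t x) (x : ℝ) :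
    zt t x = f2 (u t x) * z t x ^ 2 * (o x - u t x) + f1 (u t x) * zx t x * (o x - u t x)
      + 2 * f1 (u t x) * z t x * (o1 x - z t x) + f0 (u t x) * (o2 x - zx t x)
      + ν * zxx t x := by
  have hu := h.d_u t (Ioo_subset_Ico_self ht) x
  have hz := h.d_z t ht x
  have h0 : HasDerivAt (fun x => f0 (u t x)) (f1 (u t x) * z t x) x :=
    (hF.d0 _ (hpos x)).comp x hu
  have h1 : HasDerivAt (fun x => f1 (u t x)) (f2 (u t x) * z t x) x :=
    (hF.d1 _ (hpos x)).comp x hu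
  have key := ((h1.mul hz).mul ((ho x).sub hu)).add (h0.mul ((ho1 x).sub hz)) |>.add
    ((h.d_zx t ht x).const_mul ν)
  have hut : ut t = fun x => f1 (u t x) * z t x * (o x - u t x) + f0 (u t x) * (o1 x - z t x)
      + ν * zx t x := funext fun y => h.pde t ht y (hpos y)
  have := h.d_ut t ht x
  rw [hut] at this
  rw [this.unique key]
  simp only [Pi.sub_apply, Pi.mul_apply]
  ring

/-- The solution stays strictly below the obstacle. -/
theorem IsFlow.pos {m m' : ℝ} (hF : IsFlux f0 f1 f2 f3 g v)
    (h : IsFlow T ν f0 f1 o o1 u z zx zxx ut zt) (hν : 0 ≤ ν) (hN1 : ∀ x, |o1 x| ≤ N1)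
    (hm : 0 < m) (hmm : m < m') (ho : ∀ x, m' ≤ o x) (hinit : ∀ x, m < u 0 x) :
    ∀ t ∈ Ico 0 T, ∀ x, 0 < u t x := by
  have hN0 : 0 ≤ N1 := (abs_nonneg _).trans (hN1 0)
  have hg0 : 0 ≤ g := (hF.pos1 1 one_pos).le.trans (hF.le_slope 1 one_pos)
  -- Where `m exp(-lam t)` first touches `u` from below, `z = 0` and only `f0(u) o1` can push `u`
  -- down. Since `f0 y ≤ g y`, that push is at most `g N1 u`; the `+ 1` makes the contradiction
  -- strict.
  set lam : ℝ := g * N1 + 1 with hlam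
  have hl0 : 0 < lam := by positivity
  have main : ∀ t ∈ Ico 0 T, ∀ x, m * Real.exp (-lam * t) - u t x < 0 := by
    refine neg_of_maximum_principle (F := fun t x => m * Real.exp (-lam * t) - u t x)
      (Fx := fun t x => - z t x) (Fxx := fun t x => - zx t x)
      (Ft := fun t x => m * (Real.exp (-lam * t) * (-lam)) - ut t x) ?_ ?_ ?_ ?_ ?_ ?_ ?_
    · exact (by fun_prop : Continuous fun p : ℝ × ℝ => m * Real.exp (-lam * p.1)).continuousOn.sub
        h.cont_u
    · intro x
      simpa using hinit x
    · obtain ⟨R, hR⟩ := h.vanish ((m' - m) / 2) (by linarith)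
      refine ⟨R, fun t ht x hx => ?_⟩
      have h1 := (abs_le.1 (hR t ht x hx).1).2
      have h2 : Real.exp (-lam * t) ≤ 1 := Real.exp_le_one_iff.2 (by nlinarith [ht.1])
      have h3 := ho x
      have : m * Real.exp (-lam * t) ≤ m := by nlinarith
      linarith
    · intro t ht x
      exact (h.d_u t (Ioo_subset_Ico_self ht) x).const_sub _
    · intro t ht x
      exact (h.d_z t ht x).neg
    · intro t ht x
      refine HasDerivAt.sub (HasDerivAt.const_mul m ?_) (h.dt_u t ht x)
      exact (by simpa using (hasDerivAt_id t).const_mul (-lam) :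
        HasDerivAt (fun s => -lam * s) (-lam) t).exp
    · intro t ht x h1 h2 h3 h4
      set r := m * Real.exp (-lam * t) with hr
      have hr0 : 0 < r := by positivity
      have hu : u t x = r := by linarith
      have hz : z t x = 0 := by linarith
      have hp := h.pde t ht x (by linarith)
      rw [hz, hu] at hp
      have h5 : m * (Real.exp (-lam * t) * -lam) = -(lam * r) := by rw [hr]; ring
      rw [h5] at h4
      have h6 := hF.le_linear r hr0
      have h7 := hF.pos0 r hr0
      have h8 := (abs_le.1 (hN1 x)).1
      have h9 : f0 r * o1 x ≥ -(g * r * N1) := by nlinarith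
      have h10 : 0 ≤ ν * zx t x := mul_nonneg hν (by linarith)
      have : lam * r = g * r * N1 + r := by rw [hlam]; ring
      nlinarith
  intro t ht x
  have := main t ht x
  have h2 : 0 < m * Real.exp (-lam * t) := by positivity
  linarith

/-- The solution is nonnegative up to an error proportional to the viscosity. -/
theorem IsFlow.lower (hF : IsFlux f0 f1 f2 f3 g v)
    (h : IsFlow T ν f0 f1 o o1 u z zx zxx ut zt) (hν : 0 < ν)
    (ho : ∀ x, HasDerivAt o (o1 x) x) (ho1 : ∀ x, HasDerivAt o1 (o2 x) x)
    (hN1 : ∀ x, |o1 x| ≤ N1) (hN2 : ∀ x, |o2 x| ≤ N2)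
    (hpos : ∀ t ∈ Ico 0 T, ∀ x, 0 < u t x) (hinit : ∀ x, u 0 x ≤ o x) :
    ∀ t ∈ Ico 0 T, ∀ x, u t x - o x ≤ ν * Real.exp ((g * N1 + N2 + 1) * T) := by
  have hN0 : 0 ≤ N1 := (abs_nonneg _).trans (hN1 0)
  have hN20 : 0 ≤ N2 := (abs_nonneg _).trans (hN2 0)
  have hg0 : 0 ≤ g := (hF.pos1 1 one_pos).le.trans (hF.le_slope 1 one_pos)
  have hoc : Continuous o := continuous_iff_continuousAt.2 fun x => (ho x).continuousAt
  -- At a touching point `q = -r` and `∂ₓ q = 0`. The rate `g N1` covers the term with `f1 o1`, and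
  -- `N2` covers `ν o2`, because the barrier value `r` is at least `ν`.
  set lam : ℝ := g * N1 + N2 + 1 with hlam
  have hl0 : 0 < lam := by positivity
  have main : ∀ t ∈ Ico 0 T, ∀ x, u t x - o x - ν * Real.exp (lam * t) < 0 := by
    refine neg_of_maximum_principle (F := fun t x => u t x - o x - ν * Real.exp (lam * t))
      (Fx := fun t x => z t x - o1 x) (Fxx := fun t x => zx t x - o2 x)
      (Ft := fun t x => ut t x - ν * (Real.exp (lam * t) * lam)) ?_ ?_ ?_ ?_ ?_ ?_ ?_
    · refine (h.cont_u.sub ?_).sub ?_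
      · exact (hoc.comp continuous_snd).continuousOn
      · exact (by fun_prop : Continuous fun p : ℝ × ℝ => ν * Real.exp (lam * p.1)).continuousOn
    · intro x
      have := hinit x
      simp only [mul_zero, Real.exp_zero]
      linarith
    · obtain ⟨R, hR⟩ := h.vanish (ν / 2) (by linarith)
      refine ⟨R, fun t ht x hx => ?_⟩
      have h1 := (abs_le.1 (hR t ht x hx).1).1
      have h2 : 1 ≤ Real.exp (lam * t) := Real.one_le_exp (by nlinarith [ht.1])
      have : ν ≤ ν * Real.exp (lam * t) := by nlinarith
      linarith
    · intro t ht x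
      exact ((h.d_u t (Ioo_subset_Ico_self ht) x).sub (ho x)).sub_const _
    · intro t ht x
      exact (h.d_z t ht x).sub (ho1 x)
    · intro t ht x
      refine HasDerivAt.sub ((h.dt_u t ht x).sub_const _) (HasDerivAt.const_mul ν ?_)
      exact (by simpa using (hasDerivAt_id t).const_mul lam :
        HasDerivAt (fun s => lam * s) lam t).exp
    · intro t ht x h1 h2 h3 h4
      set r := ν * Real.exp (lam * t) with hr
      have hrν : ν ≤ r := by
        have h2 : 1 ≤ Real.exp (lam * t) := Real.one_le_exp (by nlinarith [ht.1])
        nlinarith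
      have hr0 : 0 < r := by linarith
      have hq : o x - u t x = -r := by linarith
      have hz : z t x = o1 x := by linarith
      have hup := hpos t (Ioo_subset_Ico_self ht) x
      have hp := h.pde t ht x hup
      rw [hz, hq, sub_self, mul_zero, add_zero] at hp
      have h5 : ν * (Real.exp (lam * t) * lam) = lam * r := by rw [hr]; ring
      rw [h5, hp] at h4
      have h6 := hF.le_slope _ hup
      have h7 := hF.pos1 _ hup
      have h8 := (abs_le.1 (hN1 x)).1
      have h9 : f1 (u t x) * o1 x ≥ -(g * N1) := by nlinarith
      have h10 : f1 (u t x) * o1 x * -r ≤ g * N1 * r := by nlinarith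
      have h11 := (abs_le.1 (hN2 x)).2
      have h12 : ν * zx t x ≤ r * N2 := by nlinarith
      have : lam * r = g * N1 * r + r * N2 + r := by rw [hlam]; ring
      linarith
  intro t ht x
  have h1 := main t ht x
  have h2 : Real.exp (lam * t) ≤ Real.exp (lam * T) :=
    Real.exp_le_exp.2 (by nlinarith [ht.2])
  nlinarith

/-- The one-sided bound on `∂ₓ (o - q)`. -/
theorem IsFlow.slope_le {A κ σ : ℝ} (hF : IsFlux f0 f1 f2 f3 g v)
    (h : IsFlow T ν f0 f1 o o1 u z zx zxx ut zt) (hν : 0 ≤ ν)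
    (ho : ∀ x, HasDerivAt o (o1 x) x) (ho1 : ∀ x, HasDerivAt o1 (o2 x) x)
    (hN1 : ∀ x, |o1 x| ≤ N1) (hN2 : ∀ x, |o2 x| ≤ N2)
    (hpos : ∀ t ∈ Ico 0 T, ∀ x, 0 < u t x) (hκ : ∀ t ∈ Ico 0 T, ∀ x, u t x - o x ≤ κ)
    (hκ0 : 0 ≤ κ) (hκv : κ * v ≤ 1) (hσ : ∀ t ∈ Ico 0 T, ∀ x, f0 (u t x) ≤ σ) (hσ0 : 0 ≤ σ)
    (hA : 2 * N1 ≤ A) (hinit : ∀ x, z 0 x ≤ A) :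
    ∀ t ∈ Ico 0 T, ∀ x, z t x ≤ A + σ * N2 * t := by
  have hN0 : 0 ≤ N1 := (abs_nonneg _).trans (hN1 0)
  have hN20 : 0 ≤ N2 := (abs_nonneg _).trans (hN2 0)
  have main : ∀ δ, 0 < δ → ∀ t ∈ Ico 0 T, ∀ x, z t x - (A + (σ * N2 + δ) * t + δ) < 0 := by
    intro δ hδ
    refine neg_of_maximum_principle (F := fun t x => z t x - (A + (σ * N2 + δ) * t + δ))
      (Fx := fun t x => zx t x) (Fxx := fun t x => zxx t x)
      (Ft := fun t x => zt t x - (σ * N2 + δ)) ?_ ?_ ?_ ?_ ?_ ?_ ?_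
    · exact h.cont_z.sub
        (by fun_prop : Continuous fun p : ℝ × ℝ => A + (σ * N2 + δ) * p.1 + δ).continuousOn
    · intro x
      have := hinit x
      simp only [mul_zero]
      linarith
    · obtain ⟨R, hR⟩ := h.vanish (δ / 2) (by linarith)
      refine ⟨R, fun t ht x hx => ?_⟩
      have h1 := (abs_le.1 (hR t ht x hx).2).1
      have h2 := (abs_le.1 (hN1 x)).2
      have h3 : 0 ≤ (σ * N2 + δ) * t := mul_nonneg (by positivity) ht.1
      linarith
    · intro t ht x
      exact (h.d_z t ht x).sub_const _
    · intro t ht x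
      exact h.d_zx t ht x
    · intro t ht x
      refine (h.dt_z t ht x).sub ?_
      simpa using (((hasDerivAt_id t).const_mul (σ * N2 + δ)).const_add A).add_const δ
    · intro t ht x h1 h2 h3 h4
      have ht' := Ioo_subset_Ico_self ht
      have hup := hpos t ht' x
      have he := h.eq_zt hF ho ho1 ht (hpos t ht') x
      rw [h2] at he
      have hz : z t x ≥ 2 * N1 + δ := by
        have : 0 ≤ (σ * N2 + δ) * t := mul_nonneg (by positivity) ht.1.le
        linarith
      have e0 := hF.pos0 _ hup
      have e1 := hF.pos1 _ hup
      have e2 := hF.neg2 _ hup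
      have e3 := hF.ratio _ hup
      have e4 := hκ t ht' x
      have e5 := (abs_le.1 (hN1 x)).2
      have e6 := (abs_le.1 (hN2 x)).2
      have e7 := hσ t ht' x
      have hz2 : 0 ≤ z t x ^ 2 := sq_nonneg _
      -- As `q` may be negative, `f2 q z²` can have the wrong sign. With `q ≥ -κ` and `κ v ≤ 1` it
      -- costs at most `f1 z²`, which `s3` recovers from `2 f1 z (o1 - z)` once `z ≥ 2 N1`.
      have s1 : f2 (u t x) * (o x - u t x) ≤ f1 (u t x) := by
        have a1 : f2 (u t x) * (o x - u t x) ≤ -f2 (u t x) * κ := by nlinarith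
        have a2 : -f2 (u t x) * κ ≤ v * f1 (u t x) * κ := mul_le_mul_of_nonneg_right e3 hκ0
        nlinarith
      have s2 : f2 (u t x) * z t x ^ 2 * (o x - u t x) ≤ f1 (u t x) * z t x ^ 2 := by
        nlinarith
      have s3 : 2 * f1 (u t x) * z t x * (o1 x - z t x) ≤ - (f1 (u t x) * z t x ^ 2) := by
        have a1 : 2 * (o1 x - z t x) ≤ - z t x := by linarith
        have a2 : 0 ≤ f1 (u t x) * z t x := by
          apply mul_nonneg e1.le; linarith
        nlinarith
      have s4 : f0 (u t x) * (o2 x - 0) ≤ σ * N2 := by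
        rw [sub_zero]
        nlinarith
      have s5 : ν * zxx t x ≤ 0 := by nlinarith
      nlinarith
  intro t ht x
  refine le_of_forall_pos_le_add fun η hη => ?_
  have h1 : 0 < 1 + t := by linarith [ht.1]
  -- The perturbation `δ t + δ` then totals exactly `η` at time `t`.
  have := main (η / (1 + t)) (by positivity) t ht x
  have h2 : η / (1 + t) * (1 + t) = η := by field_simp
  nlinarith

/-- The one-sided bound on `∂ₓ f₀(o - q)`. -/
theorem IsFlow.flux_slope_le {M Z k α : ℝ} (hF : IsFlux f0 f1 f2 f3 g v)
    (h : IsFlow T ν f0 f1 o o1 u z zx zxx ut zt) (hν : 0 ≤ ν)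
    (ho : ∀ x, HasDerivAt o (o1 x) x) (ho1 : ∀ x, HasDerivAt o1 (o2 x) x)
    (hN1 : ∀ x, |o1 x| ≤ N1) (hN2 : ∀ x, |o2 x| ≤ N2)
    (hpos : ∀ t ∈ Ico 0 T, ∀ x, 0 < u t x) (hZ : ∀ t ∈ Ico 0 T, ∀ x, z t x ≤ Z)
    (hM : 0 ≤ M) (hk : 0 < k) (hko : ∀ x, 2 * k ≤ o x)
    (hlarge : ∀ t ∈ Ico 0 T, ∀ x, k ≤ u t x → f1 (u t x) * z t x ≤ M)
    (hα0 : 0 ≤ α) (hα : ∀ y, 0 < y → f2 y ≤ -α * f1 y)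
    (hνZ : 2 * ν * v ^ 2 * Z ^ 3 ≤ 1)
    (hquad : ∀ W, M < W → 0 < α * k * W ^ 2 - (2 * g + v) * N1 * W - (g * N2 + g))
    (hinit : ∀ x, f1 (u 0 x) * z 0 x ≤ M) :
    ∀ t ∈ Ico 0 T, ∀ x, f1 (u t x) * z t x ≤ M := by
  have hN0 : 0 ≤ N1 := (abs_nonneg _).trans (hN1 0)
  have hN20 : 0 ≤ N2 := (abs_nonneg _).trans (hN2 0)
  have main : ∀ δ, 0 < δ → ∀ t ∈ Ico 0 T, ∀ x, f1 (u t x) * z t x - (M + δ) < 0 := by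
    intro δ hδ
    refine neg_of_maximum_principle (F := fun t x => f1 (u t x) * z t x - (M + δ))
      (Fx := fun t x => f2 (u t x) * z t x * z t x + f1 (u t x) * zx t x)
      (Fxx := fun t x => ((f3 (u t x) * z t x * z t x + f2 (u t x) * zx t x) * z t x
        + f2 (u t x) * z t x * zx t x)
        + (f2 (u t x) * z t x * zx t x + f1 (u t x) * zxx t x))
      (Ft := fun t x => f2 (u t x) * ut t x * z t x + f1 (u t x) * zt t x) ?_ ?_ ?_ ?_ ?_ ?_ ?_
    · refine (ContinuousOn.mul ?_ h.cont_z).sub continuousOn_const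
      have hc1 : ContinuousOn f1 (Ioi 0) := fun y hy => (hF.d1 y hy).continuousAt.continuousWithinAt
      exact hc1.comp h.cont_u fun p hp => hpos p.1 hp.1 p.2
    · intro x
      have := hinit x
      linarith
    -- Far away `q ≤ k` while `o ≥ 2 k`, so `u ≥ k` and `hlarge` applies.
    · obtain ⟨R, hR⟩ := h.vanish k hk
      refine ⟨R, fun t ht x hx => ?_⟩
      have h1 := (abs_le.1 (hR t ht x hx).1).2
      have h2 := hko x
      have := hlarge t ht x (by linarith)
      linarith
    · intro t ht x
      have ht' := Ioo_subset_Ico_self ht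
      exact (((hF.d1 _ (hpos t ht' x)).comp x (h.d_u t ht' x)).mul (h.d_z t ht x)).sub_const _
    · intro t ht x
      have ht' := Ioo_subset_Ico_self ht
      have c1 := (hF.d1 _ (hpos t ht' x)).comp x (h.d_u t ht' x)
      have c2 := (hF.d2 _ (hpos t ht' x)).comp x (h.d_u t ht' x)
      exact ((c2.mul (h.d_z t ht x)).mul (h.d_z t ht x)).add (c1.mul (h.d_zx t ht x))
    · intro t ht x
      have ht' := Ioo_subset_Ico_self ht
      have c1 := (hF.d1 _ (hpos t ht' x)).comp t (h.dt_u t ht x)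
      exact (c1.mul (h.dt_z t ht x)).sub_const _
    · intro t ht x h1 h2 h3 h4
      have ht' := Ioo_subset_Ico_self ht
      have hup := hpos t ht' x
      -- Where `u ≥ k` the bound is `hlarge`; hence at a touching point `u < k`, and `o ≥ 2 k`
      -- leaves `q ≥ k`, as the damping requires.
      have huk : u t x < k := by
        by_contra hc
        have := hlarge t ht' x (not_lt.1 hc)
        linarith
      have he := h.eq_zt hF ho ho1 ht (hpos t ht') x
      have hp := h.pde t ht x hup
      have e0 := hF.pos0 _ hup
      have e0' := hF.le_one _ hup
      have e1 := hF.pos1 _ hup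
      have e1' := hF.le_slope _ hup
      have e2 := hF.neg2 _ hup
      have e3 := hF.pos3 _ hup
      have e4 := hF.ratio _ hup
      have e5 := hα _ hup
      have e7 := (abs_le.1 (hN2 x)).2
      have e8 := hko x
      rw [hp, he] at h4
      have hz0 : 0 < z t x := by
        by_contra hc
        have := mul_nonpos_of_nonneg_of_nonpos e1.le (not_lt.1 hc)
        linarith
      have hquad' := hquad (f1 (u t x) * z t x) (by linarith)
      have := flux_slope_rate_le hν hα0 hk.le hN20 e0.le e0' e1 e1' e2 e3 e4 e5 (hN1 x) e7 hz0
        (hZ t ht' x) (show k ≤ o x - u t x by linarith) hνZ h2 h3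
      linarith
  intro t ht x
  refine le_of_forall_pos_le_add fun η hη => ?_
  have := main η hη t ht x
  linarith

end Flow

/-! ### From the classical solution to the flow of `o - q` -/

/-- The directional derivative of `G` along `e` within `S`. -/
noncomputable def dirDeriv (S : Set (ℝ × ℝ)) (e : ℝ × ℝ) (G : ℝ × ℝ → ℝ) (p : ℝ × ℝ) : ℝ :=
  fderivWithin ℝ G S p e

section Slab

variable {T : ℝ} {G : ℝ × ℝ → ℝ}

theorem uniqueDiffOn_slab (hT : 0 < T) : UniqueDiffOn ℝ (Icc 0 T ×ˢ (univ : Set ℝ)) :=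
  (uniqueDiffOn_Icc hT).prod uniqueDiffOn_univ

theorem contDiffOn_dirDeriv (hT : 0 < T) {n m : ℕ∞ω} (hmn : m + 1 ≤ n)
    (hG : ContDiffOn ℝ n G (Icc 0 T ×ˢ univ)) (e : ℝ × ℝ) :
    ContDiffOn ℝ m (dirDeriv (Icc 0 T ×ˢ univ) e G) (Icc 0 T ×ˢ univ) :=
  (hG.fderivWithin (uniqueDiffOn_slab hT) hmn).clm_apply contDiffOn_const

theorem hasDerivAt_snd_slab (hG : ContDiffOn ℝ 1 G (Icc 0 T ×ˢ univ)) {t : ℝ}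
    (ht : t ∈ Icc 0 T) (x : ℝ) :
    HasDerivAt (fun y => G (t, y)) (dirDeriv (Icc 0 T ×ˢ univ) (0, 1) G (t, x)) x := by
  have h1 : HasFDerivWithinAt G (fderivWithin ℝ G (Icc 0 T ×ˢ univ) (t, x)) (Icc 0 T ×ˢ univ)
      (t, x) :=
    (hG.differentiableOn one_ne_zero (t, x) ⟨ht, mem_univ _⟩).hasFDerivWithinAt
  have h2 : HasDerivWithinAt (fun y : ℝ => (t, y)) ((0 : ℝ), (1 : ℝ)) univ x :=
    ((hasDerivAt_const x t).prodMk (hasDerivAt_id x)).hasDerivWithinAt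
  exact hasDerivWithinAt_univ.1
    (h1.comp_hasDerivWithinAt x h2 fun y _ => ⟨ht, mem_univ _⟩)

theorem hasDerivAt_fst_slab (hG : ContDiffOn ℝ 1 G (Icc 0 T ×ˢ univ)) {t : ℝ}
    (ht : t ∈ Ioo 0 T) (x : ℝ) :
    HasDerivAt (fun s => G (s, x)) (dirDeriv (Icc 0 T ×ˢ univ) (1, 0) G (t, x)) t := by
  have h1 : HasFDerivWithinAt G (fderivWithin ℝ G (Icc 0 T ×ˢ univ) (t, x)) (Icc 0 T ×ˢ univ)
      (t, x) :=
    (hG.differentiableOn one_ne_zero (t, x)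
      ⟨⟨ht.1.le, ht.2.le⟩, mem_univ _⟩).hasFDerivWithinAt
  have h2 : HasDerivWithinAt (fun s : ℝ => (s, x)) ((1 : ℝ), (0 : ℝ)) (Icc 0 T) t :=
    ((hasDerivAt_id t).prodMk (hasDerivAt_const t x)).hasDerivWithinAt
  have h3 : MapsTo (fun s : ℝ => (s, x)) (Icc 0 T) (Icc 0 T ×ˢ univ) :=
    fun s hs => ⟨hs, mem_univ _⟩
  exact (h1.comp_hasDerivWithinAt t h2 h3).hasDerivAt (Icc_mem_nhds ht.1 ht.2)

/-- Both sides are the second derivative within the slab applied to the two directions. Its symmetry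
extends up to the boundary because the slab is the closure of its interior. -/
theorem dirDeriv_comm_slab (hT : 0 < T) (hG : ContDiffOn ℝ 2 G (Icc 0 T ×ˢ univ)) {p : ℝ × ℝ}
    (hp : p ∈ Icc 0 T ×ˢ (univ : Set ℝ)) (e e' : ℝ × ℝ) :
    dirDeriv (Icc 0 T ×ˢ univ) e (dirDeriv (Icc 0 T ×ˢ univ) e' G) p =
      dirDeriv (Icc 0 T ×ˢ univ) e' (dirDeriv (Icc 0 T ×ˢ univ) e G) p := by
  have hU := uniqueDiffOn_slab hT
  have hd : DifferentiableWithinAt ℝ (fderivWithin ℝ G (Icc 0 T ×ˢ univ)) (Icc 0 T ×ˢ univ) p :=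
    (hG.fderivWithin (m := 1) hU (by norm_num)).differentiableOn one_ne_zero p hp
  have key : ∀ a b : ℝ × ℝ, dirDeriv (Icc 0 T ×ˢ univ) a (dirDeriv (Icc 0 T ×ˢ univ) b G) p =
      fderivWithin ℝ (fderivWithin ℝ G (Icc 0 T ×ˢ univ)) (Icc 0 T ×ˢ univ) p a b := by
    intro a b
    have := (hd.hasFDerivWithinAt.clm_apply (hasFDerivWithinAt_const b p _)).fderivWithin (hU p hp)
    unfold dirDeriv
    rw [this]
    simp
  rw [key, key]
  refine (hG p hp).isSymmSndFDerivWithinAt (by simp) hU ?_ hp e e'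
  rw [interior_prod_eq, interior_Icc, interior_univ, closure_prod_eq, closure_Ioo hT.ne,
    closure_univ]
  exact hp

end Slab

/-- Regularity `C³` supplies `zxx` and the identity `∂ₜ z = ∂ₓ u_t`. The equation is rewritten only
where `u > 0`, since nothing is known of `V` at negative arguments. -/
theorem IsViscosityApprox.exists_isFlow {V o q₀ o1 o2 o3 f1 : ℝ → ℝ} {T ν ε : ℝ} {q : ℝ → ℝ → ℝ}
    (hT : 0 < T) (hq : IsViscosityApprox V o q₀ T ν ε q)
    (h1 : ∀ y, 0 < y → HasDerivAt (scaled V ε) (f1 y) y)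
    (ho : ∀ x, HasDerivAt o (o1 x) x) (ho1 : ∀ x, HasDerivAt o1 (o2 x) x)
    (ho2 : ∀ x, HasDerivAt o2 (o3 x) x) :
    ∃ z zx zxx ut zt, IsFlow T ν (scaled V ε) f1 o o1 (fun t x => o x - q t x) z zx zxx ut zt := by
  set S : Set (ℝ × ℝ) := Icc 0 T ×ˢ univ with hS
  set G : ℝ × ℝ → ℝ := fun p => q p.1 p.2 with hGdef
  have hG : ContDiffOn ℝ 3 G S := hq.regular
  have cx : ContDiffOn ℝ 2 (dirDeriv S (0, 1) G) S :=
    contDiffOn_dirDeriv hT (by norm_num) hG _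
  have cxx : ContDiffOn ℝ 1 (dirDeriv S (0, 1) (dirDeriv S (0, 1) G)) S :=
    contDiffOn_dirDeriv hT (by norm_num) cx _
  have ct : ContDiffOn ℝ 2 (dirDeriv S (1, 0) G) S :=
    contDiffOn_dirDeriv hT (by norm_num) hG _
  have hG1 : ContDiffOn ℝ 1 G S := hG.of_le (by norm_num)
  have cx1 := cx.of_le (m := 1) (by norm_num)
  have ct1 := ct.of_le (m := 1) (by norm_num)
  have hoc : Continuous o := continuous_iff_continuousAt.2 fun x => (ho x).continuousAt
  have ho1c : Continuous o1 := continuous_iff_continuousAt.2 fun x => (ho1 x).continuousAt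
  have hsub : Ico 0 T ×ˢ (univ : Set ℝ) ⊆ S := prod_mono Ico_subset_Icc_self subset_rfl
  have dx : ∀ t ∈ Icc 0 T, ∀ x, HasDerivAt (q t) (dirDeriv S (0, 1) G (t, x)) x :=
    fun t ht x => hasDerivAt_snd_slab hG1 ht x
  have dxx : ∀ t ∈ Icc 0 T, ∀ x, HasDerivAt (fun y => dirDeriv S (0, 1) G (t, y))
      (dirDeriv S (0, 1) (dirDeriv S (0, 1) G) (t, x)) x :=
    fun t ht x => hasDerivAt_snd_slab cx1 ht x
  have i1 : ∀ t ∈ Ico 0 T, t ∈ Icc 0 T := fun t ht => ⟨ht.1, ht.2.le⟩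
  have i2 : ∀ t ∈ Ioo 0 T, t ∈ Icc 0 T := fun t ht => ⟨ht.1.le, ht.2.le⟩
  refine ⟨fun t x => o1 x - dirDeriv S (0, 1) G (t, x),
    fun t x => o2 x - dirDeriv S (0, 1) (dirDeriv S (0, 1) G) (t, x),
    fun t x => o3 x - dirDeriv S (0, 1) (dirDeriv S (0, 1) (dirDeriv S (0, 1) G)) (t, x),
    fun t x => - dirDeriv S (1, 0) G (t, x),
    fun t x => - dirDeriv S (1, 0) (dirDeriv S (0, 1) G) (t, x), ?_⟩
  constructor
  · exact (hoc.comp continuous_snd).continuousOn.sub (hG.continuousOn.mono hsub)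
  · exact (ho1c.comp continuous_snd).continuousOn.sub (cx.continuousOn.mono hsub)
  · exact fun t ht x => (ho x).sub (dx t (i1 t ht) x)
  · exact fun t ht x => (ho1 x).sub (dxx t (i2 t ht) x)
  · exact fun t ht x => (ho2 x).sub (hasDerivAt_snd_slab cxx (i2 t ht) x)
  · exact fun t ht x => (hasDerivAt_fst_slab hG1 ht x).const_sub _
  · exact fun t ht x => (hasDerivAt_fst_slab cx1 ht x).const_sub _
  · intro t ht x
    rw [dirDeriv_comm_slab hT (hG.of_le (by norm_num)) ⟨i2 t ht, mem_univ _⟩]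
    exact (hasDerivAt_snd_slab ct1 (i2 t ht) x).neg
  · intro t ht x hup
    have hp := hq.pde t ht x
    have e1 : deriv (fun s => q s x) t = dirDeriv S (1, 0) G (t, x) :=
      (hasDerivAt_fst_slab hG1 ht x).deriv
    have d1 : HasDerivAt (fun y => o y - q t y) (o1 x - dirDeriv S (0, 1) G (t, x)) x :=
      (ho x).sub (dx t (i2 t ht) x)
    have e2 : deriv (fun y => scaled V ε (o y - q t y) * q t y) x =
        f1 (o x - q t x) * (o1 x - dirDeriv S (0, 1) G (t, x)) * q t x
          + scaled V ε (o x - q t x) * dirDeriv S (0, 1) G (t, x) := by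
      have d2 : HasDerivAt (fun y => scaled V ε (o y - q t y))
          (f1 (o x - q t x) * (o1 x - dirDeriv S (0, 1) G (t, x))) x :=
        HasDerivAt.comp (h₂ := scaled V ε) (h := fun y => o y - q t y) x (h1 _ hup) d1
      exact (d2.mul (dx t (i2 t ht) x)).deriv
    have e3 : iteratedDeriv 2 (fun y => q t y - o y) x =
        dirDeriv S (0, 1) (dirDeriv S (0, 1) G) (t, x) - o2 x := by
      have : deriv (fun y => q t y - o y) = fun y => dirDeriv S (0, 1) G (t, y) - o1 y :=
        funext fun y => ((dx t (i2 t ht) y).sub (ho y)).deriv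
      rw [iteratedDeriv_succ, iteratedDeriv_one, this]
      exact ((dxx t (i2 t ht) x).sub (ho1 x)).deriv
    rw [e1, e2, e3] at hp
    simp only [sub_sub_cancel]
    linarith
  · intro δ hδ
    obtain ⟨R, hR⟩ := hq.vanish δ hδ
    refine ⟨R, fun t ht x hx => ?_⟩
    have := hR t (i1 t ht) x hx
    rw [show deriv (fun y => q t y) x = dirDeriv S (0, 1) G (t, x) from
      (dx t (i1 t ht) x).deriv] at this
    simpa using this

/-! ### The mollifier and its smoothing errors -/

/-- A symmetric probability density on `[-ν, ν]`, bounded below by `κ / ν` on `[-ν/2, ν/2]`. -/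
structure IsKernel (k : ℝ → ℝ) (ν κ : ℝ) : Prop where
  meas : Measurable k
  nonneg : ∀ s, 0 ≤ k s
  even : ∀ s, k (-s) = k s
  bdd : ∃ B, ∀ s, k s ≤ B
  integrable : Integrable k
  integral_eq_one : ∫ s, k s = 1
  zero : ∀ s, ν < |s| → k s = 0
  lower : ∀ s, |s| ≤ ν / 2 → κ / ν ≤ k s

theorem bump_nonneg (x : ℝ) : 0 ≤ bump x := by
  unfold bump; split_ifs <;> positivity

theorem bump_le_one (x : ℝ) : bump x ≤ 1 := by
  unfold bump
  split_ifs with h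
  · rw [Real.exp_le_one_iff]
    have : x ^ 2 < 1 := (sq_lt_one_iff_abs_lt_one x).2 h
    exact div_nonpos_of_nonneg_of_nonpos zero_le_one (by linarith)
  · exact zero_le_one

theorem bump_neg (x : ℝ) : bump (-x) = bump x := by
  unfold bump; rw [abs_neg, neg_sq]

theorem bump_eq_zero {x : ℝ} (h : 1 < |x|) : bump x = 0 := if_neg (not_lt.2 h.le)

theorem measurable_bump : Measurable bump := by
  unfold bump
  exact Measurable.ite (measurableSet_lt (by fun_prop) measurable_const) (by fun_prop)
    measurable_const

theorem bump_half_pos : 0 < bump (1 / 2) := by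
  unfold bump
  rw [if_pos (by rw [abs_of_pos] <;> norm_num)]
  positivity

theorem bump_half_le {x : ℝ} (h : |x| ≤ 1 / 2) : bump (1 / 2) ≤ bump x := by
  unfold bump
  rw [if_pos (by rw [abs_of_pos] <;> norm_num), if_pos (by linarith), Real.exp_le_exp]
  have : x ^ 2 ≤ (1 / 2) ^ 2 := by
    rw [← sq_abs]; exact pow_le_pow_left₀ (abs_nonneg x) h 2
  rw [one_div_le_one_div_of_neg (by norm_num) (by linarith)]
  linarith

theorem integrable_bump : Integrable bump := by
  have h : IntegrableOn bump (Icc (-1) 1) := by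
    refine Measure.integrableOn_of_bounded (M := 1) (by simp) measurable_bump.aestronglyMeasurable
      (Eventually.of_forall fun x => ?_)
    rw [Real.norm_eq_abs, abs_of_nonneg (bump_nonneg x)]
    exact bump_le_one x
  refine h.integrable_of_forall_notMem_eq_zero fun x hx => bump_eq_zero ?_
  by_contra hc
  exact hx (abs_le.1 (not_lt.1 hc))

theorem integral_bump_pos : 0 < ∫ y, bump y := by
  have h1 : ∫ y in Icc (-(1 / 2) : ℝ) (1 / 2), bump (1 / 2) ≤
      ∫ y in Icc (-(1 / 2) : ℝ) (1 / 2), bump y :=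
    setIntegral_mono_on (by simp) integrable_bump.integrableOn measurableSet_Icc
      fun x hx => bump_half_le (abs_le.2 hx)
  have h2 : ∫ y in Icc (-(1 / 2) : ℝ) (1 / 2), bump y ≤ ∫ y, bump y :=
    setIntegral_le_integral integrable_bump (Eventually.of_forall bump_nonneg)
  rw [setIntegral_const] at h1
  have h3 := bump_half_pos
  simp only [Measure.real, Real.volume_Icc, smul_eq_mul] at h1
  norm_num at h1
  norm_num at h3
  linarith

theorem isKernel_mollifier {ν : ℝ} (hν : 0 < ν) :
    IsKernel (mollifier ν) ν (bump (1 / 2) / ∫ y, bump y) := by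
  have hI := integral_bump_pos
  refine ⟨?_, ?_, ?_, ⟨ν⁻¹ * ((∫ y, bump y)⁻¹ * 1), ?_⟩, ?_, ?_, ?_, ?_⟩
  · unfold mollifier
    have h : Measurable fun x : ℝ => x / ν := by fun_prop
    exact ((measurable_bump.comp h).const_mul _).const_mul _
  · intro s
    have := bump_nonneg (s / ν)
    unfold mollifier; positivity
  · intro s
    unfold mollifier; rw [neg_div, bump_neg]
  · intro s
    unfold mollifier
    gcongr
    exact bump_le_one _
  · exact ((integrable_bump.comp_div hν.ne').const_mul _).const_mul _
  · unfold mollifier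
    rw [integral_const_mul, integral_const_mul, Measure.integral_comp_div (fun y => bump y) ν,
      smul_eq_mul, abs_of_pos hν]
    field_simp
  · intro s hs
    unfold mollifier
    rw [bump_eq_zero, mul_zero, mul_zero]
    rw [abs_div, abs_of_pos hν, one_lt_div hν]
    exact hs
  · intro s hs
    unfold mollifier
    have : bump (1 / 2) ≤ bump (s / ν) := bump_half_le (by
      rw [abs_div, abs_of_pos hν, div_le_iff₀ hν]; linarith)
    rw [div_div, div_eq_inv_mul, mul_inv, ← mul_assoc, mul_comm ν⁻¹]
    gcongr

section Kernel

variable {k : ℝ → ℝ} {ν κ : ℝ}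

theorem IsKernel.integrable_mul_bdd (hk : IsKernel k ν κ) {f : ℝ → ℝ} (hf : Continuous f)
    {B : ℝ} (hB : ∀ x, |f x| ≤ B) : Integrable fun s => k s * f s :=
  hk.integrable.mul_bdd (c := B) hf.aestronglyMeasurable (Eventually.of_forall hB)

theorem IsKernel.integrable_mul_integrable (hk : IsKernel k ν κ) {f : ℝ → ℝ} (hf : Integrable f) :
    Integrable fun s => k s * f s := by
  obtain ⟨B, hB⟩ := hk.bdd
  refine hf.bdd_mul (c := B) hk.meas.aestronglyMeasurable (Eventually.of_forall fun s => ?_)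
  rw [Real.norm_eq_abs, abs_of_nonneg (hk.nonneg s)]
  exact hB s

theorem IsKernel.integral_mul_const (hk : IsKernel k ν κ) (c : ℝ) : ∫ s, k s * c = c := by
  rw [MeasureTheory.integral_mul_const, hk.integral_eq_one, one_mul]

theorem abs_sub_sub_le {f f' : ℝ → ℝ} {K : ℝ} (hf : ∀ x, HasDerivAt f (f' x) x)
    (hK : ∀ x, |f' x| ≤ K) (x y : ℝ) : |f x - f y| ≤ K * |x - y| := by
  have := convex_univ.norm_image_sub_le_of_norm_hasDerivWithin_le (f := f) (f' := f')
    (fun x _ => (hf x).hasDerivWithinAt) (fun x _ => hK x) (mem_univ y) (mem_univ x)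
  simpa using this

theorem IsKernel.abs_sub_smoothing_le (hk : IsKernel k ν κ) {f f' : ℝ → ℝ} {B K : ℝ}
    (hf : ∀ x, HasDerivAt f (f' x) x) (hB : ∀ x, |f x| ≤ B) (hK : ∀ x, |f' x| ≤ K) (x : ℝ) :
    |f x - ∫ s, k s * f (x - s)| ≤ K * ν := by
  have hfc : Continuous f := continuous_iff_continuousAt.2 fun x => (hf x).continuousAt
  have hK0 : 0 ≤ K := (abs_nonneg _).trans (hK 0)
  have e : f x - ∫ s, k s * f (x - s) = ∫ s, k s * (f x - f (x - s)) := by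
    simp_rw [mul_sub]
    rw [integral_sub (hk.integrable.mul_const _)
      (hk.integrable_mul_bdd (f := fun s => f (x - s)) (by fun_prop) fun s => hB _),
      hk.integral_mul_const]
  rw [e, ← Real.norm_eq_abs]
  calc _ ≤ ∫ s, k s * (K * ν) := by
        refine norm_integral_le_of_norm_le (hk.integrable.mul_const _)
          (Eventually.of_forall fun s => ?_)
        rw [norm_mul, Real.norm_eq_abs, Real.norm_eq_abs, abs_of_nonneg (hk.nonneg s)]
        rcases le_or_gt |s| ν with h | h
        · refine mul_le_mul_of_nonneg_left ?_ (hk.nonneg s)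
          have := abs_sub_sub_le hf hK x (x - s)
          rw [sub_sub_cancel] at this
          exact this.trans (mul_le_mul_of_nonneg_left h hK0)
        · simp [hk.zero s h]
    _ = K * ν := hk.integral_mul_const _

/-- An even kernel annihilates the linear Taylor term. The extra power of `ν` lets this error lose
against the first-order gain in `initDist_dichotomy`. -/
theorem IsKernel.abs_sub_smoothing_le_sq (hk : IsKernel k ν κ) {f f' f'' : ℝ → ℝ} {B K : ℝ}
    (hf : ∀ x, HasDerivAt f (f' x) x) (hf' : ∀ x, HasDerivAt f' (f'' x) x)
    (hB : ∀ x, |f x| ≤ B) (hK : ∀ x, |f'' x| ≤ K) (hν : 0 ≤ ν) (x : ℝ) :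
    |f x - ∫ s, k s * f (x - s)| ≤ K * ν ^ 2 := by
  have hfc : Continuous f := continuous_iff_continuousAt.2 fun x => (hf x).continuousAt
  have hK0 : 0 ≤ K := (abs_nonneg _).trans (hK 0)
  have hodd : ∫ s, k s * s = 0 := by
    have h1 : ∫ s, k (-s) * (-s) = ∫ s, k s * s := integral_neg_eq_self (fun s => k s * s) volume
    simp_rw [hk.even, mul_neg] at h1
    rw [integral_neg] at h1
    linarith
  have hi1 : Integrable fun s => k s * s := by
    refine (hk.integrable.mul_const ν).mono' (hk.meas.mul measurable_id).aestronglyMeasurable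
      (Eventually.of_forall fun s => ?_)
    rw [norm_mul, Real.norm_eq_abs, Real.norm_eq_abs, abs_of_nonneg (hk.nonneg s)]
    rcases le_or_gt |s| ν with h | h
    · exact mul_le_mul_of_nonneg_left h (hk.nonneg s)
    · simp [hk.zero s h]
  have e : f x - ∫ s, k s * f (x - s) = ∫ s, k s * (f x - f (x - s) - s * f' x) := by
    have : ∀ s, k s * (f x - f (x - s) - s * f' x) =
        k s * f x - k s * f (x - s) - k s * s * f' x := fun s => by ring
    simp_rw [this]
    have hi2 := hk.integrable_mul_bdd (f := fun s => f (x - s)) (by fun_prop) fun s => hB _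
    have hi3 : Integrable fun s => k s * f x - k s * f (x - s) :=
      (hk.integrable.mul_const _).sub hi2
    rw [integral_sub hi3 (hi1.mul_const _),
      integral_sub (hk.integrable.mul_const _) hi2, hk.integral_mul_const,
      MeasureTheory.integral_mul_const, hodd]
    ring
  rw [e, ← Real.norm_eq_abs]
  calc _ ≤ ∫ s, k s * (K * ν ^ 2) := by
        refine norm_integral_le_of_norm_le (hk.integrable.mul_const _)
          (Eventually.of_forall fun s => ?_)
        rw [norm_mul, Real.norm_eq_abs, Real.norm_eq_abs, abs_of_nonneg (hk.nonneg s)]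
        rcases le_or_gt |s| ν with h | h
        · refine mul_le_mul_of_nonneg_left ?_ (hk.nonneg s)
          -- With the tangent slope at `x` removed, the derivative is at most `K ν` on the segment,
          -- so the mean value inequality gives the quadratic bound.
          have hd : ∀ y, HasDerivAt (fun y => f y - y * f' x) (f' y - f' x) y := fun y =>
            (hf y).sub (by simpa using (hasDerivAt_id y).mul_const (f' x))
          have hb := (convex_uIcc x (x - s)).norm_image_sub_le_of_norm_hasDerivWithin_le
            (f := fun y => f y - y * f' x) (f' := fun y => f' y - f' x) (C := K * ν)
            (fun y _ => (hd y).hasDerivWithinAt) (fun y hy => by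
              have h1 := abs_sub_sub_le hf' hK y x
              have h2 : |y - x| ≤ |x - s - x| := abs_sub_left_of_mem_uIcc hy
              rw [show x - s - x = -s by ring, abs_neg] at h2
              exact h1.trans (mul_le_mul_of_nonneg_left (h2.trans h) hK0))
            right_mem_uIcc left_mem_uIcc
          rw [Real.norm_eq_abs, Real.norm_eq_abs, sub_sub_cancel] at hb
          rw [show f x - f (x - s) - s * f' x = f x - x * f' x - (f (x - s) - (x - s) * f' x) by
            ring]
          refine hb.trans ?_
          calc K * ν * |s| ≤ K * ν * ν := mul_le_mul_of_nonneg_left h (by positivity)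
            _ = _ := by ring
        · simp [hk.zero s h]
    _ = K * ν ^ 2 := hk.integral_mul_const _

end Kernel

/-! ### Slope and size of the mollified initial distance -/

/-- Averaged increments of a nonincreasing function dominate its drop over an inner interval. -/
theorem mul_drop_le_integral_of_antitone {d : ℝ → ℝ} (hd : Antitone d) {b h : ℝ} (hh : 0 ≤ h)
    (hb : 2 * h ≤ b) (x : ℝ) :
    h * (d (x - b / 2) - d (x + b)) ≤ ∫ s in (-b)..b, (d (x - s) - d (x + h - s)) := by
  have hi : ∀ p q, IntervalIntegrable d volume p q := fun p q => hd.intervalIntegrable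
  have hr : ∀ y, IntervalIntegrable (fun s => d (y - s)) volume (-b) b := fun y =>
    Monotone.intervalIntegrable fun s s' hs => hd (by linarith)
  rw [intervalIntegral.integral_sub (hr x) (hr (x + h)),
    intervalIntegral.integral_comp_sub_left d x,
    intervalIntegral.integral_comp_sub_left d (x + h)]
  -- The shifted windows share their middle part, which cancels; two end pieces of length `h`
  -- remain. The condition `2 h ≤ b` keeps the left piece to the left of `x - b / 2`.
  have e1 : (∫ s in (x - b)..(x - -b), d s) =
      (∫ s in (x - b)..(x + h - b), d s) + ∫ s in (x + h - b)..(x - -b), d s :=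
    (intervalIntegral.integral_add_adjacent_intervals (hi _ _) (hi _ _)).symm
  have e2 : (∫ s in (x + h - b)..(x + h - -b), d s) =
      (∫ s in (x + h - b)..(x - -b), d s) + ∫ s in (x - -b)..(x + h - -b), d s :=
    (intervalIntegral.integral_add_adjacent_intervals (hi _ _) (hi _ _)).symm
  have l1 : h * d (x - b / 2) ≤ ∫ s in (x - b)..(x + h - b), d s := by
    have := intervalIntegral.integral_mono_on (a := x - b) (b := x + h - b) (by linarith)
      (intervalIntegrable_const (c := d (x - b / 2))) (hi _ _)
      fun s hs => hd (by linarith [hs.2])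
    rw [intervalIntegral.integral_const, smul_eq_mul] at this
    linarith [show (x + h - b - (x - b)) * d (x - b / 2) = h * d (x - b / 2) by ring]
  have l2 : (∫ s in (x - -b)..(x + h - -b), d s) ≤ h * d (x + b) := by
    have := intervalIntegral.integral_mono_on (a := x - -b) (b := x + h - -b) (by linarith)
      (hi _ _) (intervalIntegrable_const (c := d (x + b)))
      fun s hs => hd (by linarith [hs.1])
    rw [intervalIntegral.integral_const, smul_eq_mul] at this
    linarith [show (x + h - -b - (x - -b)) * d (x + b) = h * d (x + b) by ring]
  rw [e1, e2]
  linarith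

theorem deriv_le_of_increment_le {f : ℝ → ℝ} {f' x B η : ℝ} (hf : HasDerivAt f f' x) (hη : 0 < η)
    (h : ∀ h, 0 < h → h < η → f (x + h) - f x ≤ B * h) : f' ≤ B := by
  have ht := (hasDerivWithinAt_iff_tendsto_slope' (by simp)).1
    (hf.hasDerivWithinAt (s := Ioi x))
  refine le_of_tendsto ht ?_
  filter_upwards [Ioo_mem_nhdsGT (show x < x + η by linarith)] with y hy
  rw [slope_def_field, div_le_iff₀ (by linarith [hy.1])]
  have := h (y - x) (by linarith [hy.1]) (by linarith [hy.2])
  rwa [add_sub_cancel] at this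

/-- The initial distance to the obstacle after mollification of the datum. -/
noncomputable def initDist (k o q₀ : ℝ → ℝ) (x : ℝ) : ℝ := o x - ∫ s, k s * q₀ (x - s)

theorem mollify_eq (ν : ℝ) (q₀ : ℝ → ℝ) (x : ℝ) :
    mollify ν q₀ x = ∫ s, mollifier ν s * q₀ (x - s) := by
  have := integral_sub_left_eq_self (fun s => mollifier ν s * q₀ (x - s)) volume x
  rw [← this]
  simp [mollify]

section Init

variable {k o q₀ o1 o2 o3 : ℝ → ℝ} {ν κ B N1 N2 K3 c a : ℝ}

/-- Only `q₀` is mollified, not `o`. The splitting separates the smoothing error of the regular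
obstacle from a true average of the gap `o - q₀`, to which the hypotheses on the data apply. -/
theorem initDist_eq (hk : IsKernel k ν κ) (hq : Integrable q₀) (hoc : Continuous o)
    (hB : ∀ x, |o x| ≤ B) (x : ℝ) :
    initDist k o q₀ x = (o x - ∫ s, k s * o (x - s)) + ∫ s, k s * (o (x - s) - q₀ (x - s)) := by
  have h1 : Integrable fun s => k s * o (x - s) :=
    hk.integrable_mul_bdd (f := fun s => o (x - s)) (by fun_prop) fun s => hB _
  have h2 : Integrable fun s => k s * q₀ (x - s) :=
    hk.integrable_mul_integrable (hq.comp_sub_left x)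
  simp_rw [mul_sub]
  rw [integral_sub h1 h2, initDist]
  ring

theorem integrable_kernel_gap (hk : IsKernel k ν κ) (hq : Integrable q₀) (hoc : Continuous o)
    (hB : ∀ x, |o x| ≤ B) (x : ℝ) : Integrable fun s => k s * (o (x - s) - q₀ (x - s)) := by
  simp_rw [mul_sub]
  exact (hk.integrable_mul_bdd (f := fun s => o (x - s)) (by fun_prop) fun s => hB _).sub
    (hk.integrable_mul_integrable (hq.comp_sub_left x))

theorem le_average (hk : IsKernel k ν κ) (hq : Integrable q₀) (hoc : Continuous o)
    (hB : ∀ x, |o x| ≤ B) (hgap : ∀ᵐ x, c ≤ o x - q₀ x) (x : ℝ) :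
    c ≤ ∫ s, k s * (o (x - s) - q₀ (x - s)) := by
  rw [← hk.integral_mul_const c]
  refine integral_mono_ae (hk.integrable.mul_const _) (integrable_kernel_gap hk hq hoc hB x) ?_
  have := (Measure.measurePreserving_sub_left volume x).quasiMeasurePreserving.ae hgap
  filter_upwards [this] with s hs
  exact mul_le_mul_of_nonneg_left hs (hk.nonneg s)

theorem le_initDist (hk : IsKernel k ν κ) (hq : Integrable q₀) (ho : ∀ x, HasDerivAt o (o1 x) x)
    (hB : ∀ x, |o x| ≤ B) (hN1 : ∀ x, |o1 x| ≤ N1) (hgap : ∀ᵐ x, c ≤ o x - q₀ x) (x : ℝ) :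
    c - N1 * ν ≤ initDist k o q₀ x := by
  have hoc : Continuous o := continuous_iff_continuousAt.2 fun x => (ho x).continuousAt
  rw [initDist_eq hk hq hoc hB]
  have h1 := (abs_le.1 (hk.abs_sub_smoothing_le ho hB hN1 x)).1
  have h2 := le_average hk hq hoc hB hgap x
  linarith

theorem le_initDist_sq (hk : IsKernel k ν κ) (hq : Integrable q₀)
    (ho : ∀ x, HasDerivAt o (o1 x) x) (ho1 : ∀ x, HasDerivAt o1 (o2 x) x)
    (hB : ∀ x, |o x| ≤ B) (hN2 : ∀ x, |o2 x| ≤ N2) (hν : 0 ≤ ν) (x : ℝ) :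
    (∫ s, k s * (o (x - s) - q₀ (x - s))) - N2 * ν ^ 2 ≤ initDist k o q₀ x := by
  have hoc : Continuous o := continuous_iff_continuousAt.2 fun x => (ho x).continuousAt
  rw [initDist_eq hk hq hoc hB]
  have h1 := (abs_le.1 (hk.abs_sub_smoothing_le_sq ho ho1 hB hN2 hν x)).1
  linarith

/-- The increments of the mollified distance, up to the smoothing error of the obstacle. -/
theorem initDist_increment (hk : IsKernel k ν κ) (hq : Integrable q₀)
    (hoc : Continuous o) (hB : ∀ x, |o x| ≤ B) (x h : ℝ) :
    initDist k o q₀ (x + h) - initDist k o q₀ x =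
      ((o (x + h) - o x) - ∫ s, k s * (o (x - s + h) - o (x - s)))
      + ∫ s, k s * ((o (x + h - s) - q₀ (x + h - s)) - (o (x - s) - q₀ (x - s))) := by
  have h1 : ∀ y, Integrable fun s => k s * o (y - s) := fun y =>
    hk.integrable_mul_bdd (f := fun s => o (y - s)) (by fun_prop) fun s => hB _
  have h3 := integrable_kernel_gap hk hq hoc hB
  have e1 : ∫ s, k s * (o (x - s + h) - o (x - s)) =
      (∫ s, k s * o (x + h - s)) - ∫ s, k s * o (x - s) := by
    rw [← integral_sub (h1 _) (h1 _)]
    congr 1; ext s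
    rw [mul_sub, show x - s + h = x + h - s by ring]
  have e2 : ∫ s, k s * ((o (x + h - s) - q₀ (x + h - s)) - (o (x - s) - q₀ (x - s))) =
      (∫ s, k s * (o (x + h - s) - q₀ (x + h - s))) - ∫ s, k s * (o (x - s) - q₀ (x - s)) := by
    rw [← integral_sub (h3 _) (h3 _)]
    congr 1; ext s
    rw [mul_sub]
  rw [initDist_eq hk hq hoc hB, initDist_eq hk hq hoc hB, e1, e2]
  ring

theorem integrable_increment (hk : IsKernel k ν κ) (hq : Integrable q₀)
    (hoc : Continuous o) (hB : ∀ x, |o x| ≤ B) (x h : ℝ) :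
    Integrable fun s => k s * ((o (x + h - s) - q₀ (x + h - s)) - (o (x - s) - q₀ (x - s))) := by
  simp_rw [mul_sub (k _) (o (x + h - _) - q₀ (x + h - _))]
  exact (integrable_kernel_gap hk hq hoc hB _).sub (integrable_kernel_gap hk hq hoc hB _)

theorem average_increment_le (hk : IsKernel k ν κ) (hq : Integrable q₀)
    (hoc : Continuous o) (hB : ∀ x, |o x| ≤ B)
    (ha : ∀ x y, x < y → (o y - q₀ y) - (o x - q₀ x) ≤ a * (y - x)) (x : ℝ) {h : ℝ} (hh : 0 < h) :
    ∫ s, k s * ((o (x + h - s) - q₀ (x + h - s)) - (o (x - s) - q₀ (x - s))) ≤ a * h := by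
  rw [← hk.integral_mul_const (a * h)]
  refine integral_mono (integrable_increment hk hq hoc hB x h) (hk.integrable.mul_const _)
    fun s => ?_
  refine mul_le_mul_of_nonneg_left ?_ (hk.nonneg s)
  have := ha (x - s) (x + h - s) (by linarith)
  linarith [show a * (x + h - s - (x - s)) = a * h by ring]

/-- Averaging preserves the one-sided increment bound `a`; the term `N2 * ν` is the first-order
smoothing error of the increments of `o`. -/
theorem deriv_initDist_le (hk : IsKernel k ν κ) (hq : Integrable q₀)
    (ho : ∀ x, HasDerivAt o (o1 x) x) (ho1 : ∀ x, HasDerivAt o1 (o2 x) x)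
    (hB : ∀ x, |o x| ≤ B) (hN2 : ∀ x, |o2 x| ≤ N2)
    (ha : ∀ x y, x < y → (o y - q₀ y) - (o x - q₀ x) ≤ a * (y - x)) {x z : ℝ}
    (hz : HasDerivAt (initDist k o q₀) z x) : z ≤ a + N2 * ν := by
  have hoc : Continuous o := continuous_iff_continuousAt.2 fun x => (ho x).continuousAt
  refine deriv_le_of_increment_le hz one_pos fun h hh _ => ?_
  rw [initDist_increment hk hq hoc hB]
  have h1 := average_increment_le hk hq hoc hB ha x hh
  have h2 := hk.abs_sub_smoothing_le (f := fun y => o (y + h) - o y)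
    (f' := fun y => o1 (y + h) - o1 y) (B := B + B) (K := N2 * h)
    (fun y => ((ho (y + h)).comp_add_const y h).sub (ho y))
    (fun y => (abs_sub _ _).trans (add_le_add (hB _) (hB _)))
    (fun y => by
      have := abs_sub_sub_le ho1 hN2 (y + h) y
      rwa [add_sub_cancel_left, abs_of_pos hh] at this) x
  have h3 := (abs_le.1 h2).2
  linarith [show (a + N2 * ν) * h = N2 * h * ν + a * h by ring]

/-- Where the mollified distance is nearly as steep as possible, it exceeds its lower bound by
an amount proportional to the mollification radius. -/
theorem initDist_dichotomy (hk : IsKernel k ν κ) (hν : 0 < ν) (hκ : 0 ≤ κ) (hq : Integrable q₀)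
    (ho : ∀ x, HasDerivAt o (o1 x) x) (ho1 : ∀ x, HasDerivAt o1 (o2 x) x)
    (ho2 : ∀ x, HasDerivAt o2 (o3 x) x)
    (hB : ∀ x, |o x| ≤ B) (hN2 : ∀ x, |o2 x| ≤ N2) (hK3 : ∀ x, |o3 x| ≤ K3)
    (hgap : ∀ᵐ x, c ≤ o x - q₀ x) (ha0 : 0 ≤ a)
    (ha : ∀ x y, x < y → (o y - q₀ y) - (o x - q₀ x) ≤ a * (y - x)) {x z : ℝ}
    (hz : HasDerivAt (initDist k o q₀) z x) :
    (z ≤ a + K3 * ν ^ 2 ∧ c + κ * a * ν / 32 - N2 * ν ^ 2 ≤ initDist k o q₀ x) ∨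
    (z ≤ a - κ * a / 16 + K3 * ν ^ 2 ∧ c - N2 * ν ^ 2 ≤ initDist k o q₀ x) := by
  have hoc : Continuous o := continuous_iff_continuousAt.2 fun x => (ho x).continuousAt
  -- Removing the maximal slope makes the gap nonincreasing. Its drop `D` across the inner window
  -- measures how far the gap is from having slope `a` there.
  set d : ℝ → ℝ := fun y => o y - q₀ y - a * y with hd
  have hda : Antitone d := by
    intro y y' hy
    rcases eq_or_lt_of_le hy with rfl | h
    · rfl
    · have := ha y y' h
      simp only [hd]
      linarith [show a * (y' - y) = a * y' - a * y by ring]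
  set D := d (x - ν / 4) - d (x + ν / 2) with hD
  have hD0 : 0 ≤ D := sub_nonneg.2 (hda (by linarith))
  have hslope : z ≤ a - κ / ν * D + K3 * ν ^ 2 := by
    refine deriv_le_of_increment_le hz (show 0 < ν / 4 by linarith) fun h hh hh' => ?_
    rw [initDist_increment hk hq hoc hB]
    have h2 := hk.abs_sub_smoothing_le_sq (f := fun y => o (y + h) - o y)
      (f' := fun y => o1 (y + h) - o1 y) (f'' := fun y => o2 (y + h) - o2 y) (B := B + B)
      (K := K3 * h)
      (fun y => ((ho (y + h)).comp_add_const y h).sub (ho y))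
      (fun y => ((ho1 (y + h)).comp_add_const y h).sub (ho1 y))
      (fun y => (abs_sub _ _).trans (add_le_add (hB _) (hB _)))
      (fun y => by
        have := abs_sub_sub_le ho2 hK3 (y + h) y
        rwa [add_sub_cancel_left, abs_of_pos hh] at this) hν.le x
    have h3 := (abs_le.1 h2).2
    have hI := integrable_increment hk hq hoc hB x h
    have hJ : Integrable fun s => k s * (d (x - s) - d (x + h - s)) := by
      refine ((hk.integrable.mul_const (a * h)).sub hI).congr (Eventually.of_forall fun s => ?_)
      simp only [hd, Pi.sub_apply]; ring
    have e1 : ∫ s, k s * ((o (x + h - s) - q₀ (x + h - s)) - (o (x - s) - q₀ (x - s))) =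
        a * h - ∫ s, k s * (d (x - s) - d (x + h - s)) := by
      rw [← hk.integral_mul_const (a * h), ← integral_sub (hk.integrable.mul_const _) hJ]
      congr 1; ext s
      simp only [hd]; ring
    have hge : ∀ s, 0 ≤ d (x - s) - d (x + h - s) := fun s => sub_nonneg.2 (hda (by linarith))
    have h4 : κ / ν * ∫ s in (-(ν / 2))..(ν / 2), (d (x - s) - d (x + h - s)) ≤
        ∫ s, k s * (d (x - s) - d (x + h - s)) := by
      rw [intervalIntegral.integral_of_le (by linarith), ← integral_const_mul]
      refine le_trans ?_ (setIntegral_le_integral (s := Ioc (-(ν / 2)) (ν / 2)) hJ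
        (Eventually.of_forall fun s => mul_nonneg (hk.nonneg s) (hge s)))
      refine integral_mono_of_nonneg (Eventually.of_forall fun s =>
        mul_nonneg (by positivity) (hge s)) hJ.integrableOn ?_
      filter_upwards [ae_restrict_mem measurableSet_Ioc] with s hs
      exact mul_le_mul_of_nonneg_right (hk.lower s (abs_le.2 ⟨hs.1.le, hs.2⟩)) (hge s)
    have h5 := mul_drop_le_integral_of_antitone hda (b := ν / 2) hh.le (by linarith) x
    have h6 : κ / ν * (h * D) ≤ _ := (mul_le_mul_of_nonneg_left
      (by rw [hD, show x - ν / 4 = x - ν / 2 / 2 by ring]; exact h5) (by positivity)).trans h4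
    rw [e1]
    linarith [show (a - κ / ν * D + K3 * ν ^ 2) * h = K3 * h * ν ^ 2 + a * h - κ / ν * (h * D) by
      ring]
  have hsq := le_initDist_sq hk hq ho ho1 hB hN2 hν.le x
  -- A small drop means the gap climbs almost at slope `a`, hence exceeds `c` to the right of `x`; a
  -- large drop lowers the mollified slope through `hslope`.
  rcases le_or_gt D (a * ν / 16) with hcase | hcase
  · left
    refine ⟨?_, ?_⟩
    · have : 0 ≤ κ / ν * D := by positivity
      linarith
    · have havg : c + κ * a * ν / 32 ≤ ∫ s, k s * (o (x - s) - q₀ (x - s)) := by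
        obtain ⟨y, hy, hyc⟩ : ∃ y ∈ Ioo (x - ν / 4) (x - ν / 8), c ≤ o y - q₀ y := by
          have hdense := Measure.dense_of_ae hgap
          obtain ⟨y, h1, h2⟩ := hdense.exists_mem_open isOpen_Ioo
            (nonempty_Ioo.2 (show x - ν / 4 < x - ν / 8 by linarith))
          exact ⟨y, h2, h1⟩
        -- The climb from `y ≤ x - ν / 8` to `x - s ≥ x` gains at least `a ν / 8`, of which the drop
        -- takes back at most `a ν / 16`.
        have hlow : ∀ s ∈ Icc (-(ν / 2)) 0, c + a * ν / 16 ≤ o (x - s) - q₀ (x - s) := by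
          intro s hs
          have g1 : d (x + ν / 2) ≤ d (x - s) := hda (by linarith [hs.1])
          have g2 : d y ≤ d (x - ν / 4) := hda hy.1.le
          simp only [hd] at g1 g2 hD
          have g3 : a * (x - s) - a * y ≥ a * (ν / 8) := by
            rw [← mul_sub]; exact mul_le_mul_of_nonneg_left (by linarith [hy.2, hs.2]) ha0
          linarith
        have hi1 := integrable_kernel_gap hk hq hoc hB x
        have hi2 : Integrable fun s => k s * (o (x - s) - q₀ (x - s) - c) := by
          simp_rw [mul_sub (k _) (o _ - q₀ _)]
          exact hi1.sub (hk.integrable.mul_const c)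
        have e : ∫ s, k s * (o (x - s) - q₀ (x - s)) =
            c + ∫ s, k s * (o (x - s) - q₀ (x - s) - c) := by
          simp_rw [mul_sub (k _) (o _ - q₀ _)]
          rw [integral_sub hi1 (hk.integrable.mul_const c), hk.integral_mul_const]
          ring
        have hae : ∀ᵐ s, 0 ≤ k s * (o (x - s) - q₀ (x - s) - c) := by
          have := (Measure.measurePreserving_sub_left volume x).quasiMeasurePreserving.ae hgap
          filter_upwards [this] with s hs
          exact mul_nonneg (hk.nonneg s) (by linarith)
        have h1 := setIntegral_le_integral (s := Icc (-(ν / 2)) 0) hi2 hae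
        have h2 : ∫ s in Icc (-(ν / 2)) 0, κ / ν * (a * ν / 16) ≤
            ∫ s in Icc (-(ν / 2)) 0, k s * (o (x - s) - q₀ (x - s) - c) := by
          refine setIntegral_mono_on (integrableOn_const (by simp)) hi2.integrableOn
            measurableSet_Icc fun s hs => ?_
          refine mul_le_mul (hk.lower s ?_) (by linarith [hlow s hs]) (by positivity) (hk.nonneg s)
          exact abs_le.2 ⟨hs.1, by linarith [hs.2]⟩
        rw [setIntegral_const] at h2
        simp only [Measure.real, Real.volume_Icc, smul_eq_mul, sub_neg_eq_add, zero_add] at h2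
        rw [ENNReal.toReal_ofReal (by linarith)] at h2
        have h3 : ν / 2 * (κ / ν * (a * ν / 16)) = κ * a * ν / 32 := by field_simp; ring
        linarith
      linarith
  · right
    refine ⟨?_, ?_⟩
    · have h1 : κ / ν * (a * ν / 16) ≤ κ / ν * D :=
        mul_le_mul_of_nonneg_left hcase.le (by positivity)
      have h2 : κ / ν * (a * ν / 16) = κ * a / 16 := by field_simp
      linarith
    · have := le_average hk hq hoc hB hgap x
      linarith

end Init

/-! ### Profile bounds and rescaling -/

/-- Every point, the endpoint `c` included, is a limit from the right of points where the essential
bound holds. -/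
theorem abs_le_normLinf_Ici {f : ℝ → ℝ} {c : ℝ} (hf : ContinuousOn f (Ici c))
    (hm : eLpNorm f ⊤ (volume.restrict (Ici c)) ≠ ⊤) {x : ℝ} (hx : c ≤ x) :
    |f x| ≤ normLinf (Ici c) f := by
  have hae : ∀ᵐ y, y ∈ Ici c → |f y| ≤ normLinf (Ici c) f := by
    rw [← ae_restrict_iff' measurableSet_Ici]
    filter_upwards [ae_le_eLpNormEssSup (f := f) (μ := volume.restrict (Ici c))] with y hy
    rw [normLinf, eLpNorm_exponent_top]
    rw [eLpNorm_exponent_top] at hm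
    simpa using (ENNReal.toReal_le_toReal (by simp) hm).2 hy
  have hd := Measure.dense_of_ae hae
  have ht : Tendsto (fun y => |f y|) (𝓝[>] x) (𝓝 |f x|) :=
    ((hf x hx).mono fun y (hy : x < y) => hx.trans hy.le).abs
  refine le_of_tendsto_of_frequently ht ?_
  rw [(nhdsGT_basis x).frequently_iff]
  intro b hb
  obtain ⟨y, h1, h2⟩ := hd.exists_mem_open isOpen_Ioo (nonempty_Ioo.2 hb)
  exact ⟨y, h2, h1 (hx.trans h2.1.le)⟩

theorem normLinf_nonneg (S : Set ℝ) (f : ℝ → ℝ) : 0 ≤ normLinf S f := ENNReal.toReal_nonneg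

theorem eLpNorm_top_ne_top_of_bound {f : ℝ → ℝ} {S : Set ℝ} (hS : MeasurableSet S) {B : ℝ}
    (hB : ∀ x ∈ S, |f x| ≤ B) : eLpNorm f ⊤ (volume.restrict S) ≠ ⊤ := by
  rw [eLpNorm_exponent_top]
  refine ne_top_of_le_ne_top ENNReal.ofReal_ne_top (eLpNormEssSup_le_of_ae_bound (C := B) ?_)
  filter_upwards [ae_restrict_mem hS] with x hx using hB x hx

theorem dV_zero (V : ℝ → ℝ) : dV V 0 = V := by
  ext x; simp [dV]

section Profile

variable {V : ℝ → ℝ} {ε : ℝ}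

theorem IsProfile.hasDerivWithinAt_dV (hV : IsProfile V) (k : ℕ) {x : ℝ} (hx : 0 ≤ x) :
    HasDerivWithinAt (dV V k) (dV V (k + 1) x) (Ici 0) x := by
  have h : DifferentiableWithinAt ℝ (dV V k) (Ici 0) x :=
    hV.smooth.differentiableOn_iteratedDerivWithin (m := k)
      (by exact_mod_cast (WithTop.coe_lt_top k)) (uniqueDiffOn_Ici 0) x hx
  have e : dV V (k + 1) x = derivWithin (dV V k) (Ici 0) x := by
    unfold dV
    rw [iteratedDerivWithin_succ]
  rw [e]
  exact h.hasDerivWithinAt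

theorem IsProfile.hasDerivAt_dV (hV : IsProfile V) (k : ℕ) {x : ℝ} (hx : 0 < x) :
    HasDerivAt (dV V k) (dV V (k + 1) x) x :=
  (hV.hasDerivWithinAt_dV k hx.le).hasDerivAt (Ici_mem_nhds hx)

theorem IsProfile.continuousOn_dV (hV : IsProfile V) (k : ℕ) : ContinuousOn (dV V k) (Ici 0) :=
  fun _ hx => (hV.hasDerivWithinAt_dV k hx).continuousWithinAt

theorem IsProfile.abs_dV_le (hV : IsProfile V) (k : ℕ) {x : ℝ} (hx : 0 ≤ x) :
    |dV V k x| ≤ normLinf (Ici 0) (dV V k) :=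
  abs_le_normLinf_Ici (hV.continuousOn_dV k) (hV.memLinf k).eLpNorm_ne_top hx

theorem IsProfile.dV_one_pos (hV : IsProfile V) {x : ℝ} (hx : 0 ≤ x) : 0 < dV V 1 x := by
  simpa using hV.sign 1 le_rfl x hx

theorem IsProfile.dV_two_neg (hV : IsProfile V) {x : ℝ} (hx : 0 ≤ x) : dV V 2 x < 0 := by
  have := hV.sign 2 one_le_two x hx
  norm_num at this
  exact this

theorem IsProfile.dV_three_pos (hV : IsProfile V) {x : ℝ} (hx : 0 ≤ x) : 0 < dV V 3 x := by
  have := hV.sign 3 (by norm_num) x hx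
  norm_num at this
  exact this

theorem IsProfile.strictMonoOn (hV : IsProfile V) : StrictMonoOn V (Ici 0) := by
  have hc := hV.continuousOn_dV 0
  rw [dV_zero] at hc
  refine strictMonoOn_of_deriv_pos (convex_Ici 0) hc fun x hx => ?_
  rw [interior_Ici] at hx
  have := hV.hasDerivAt_dV 0 hx
  rw [dV_zero] at this
  rw [this.deriv]
  exact hV.dV_one_pos hx.le

theorem IsProfile.le_one (hV : IsProfile V) {x : ℝ} (hx : 0 ≤ x) : V x ≤ 1 := by
  have := hV.abs_dV_le 0 hx
  rw [dV_zero, hV.norm_eq_one] at this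
  exact (le_abs_self _).trans this

theorem IsProfile.lt_one (hV : IsProfile V) {x : ℝ} (hx : 0 ≤ x) : V x < 1 :=
  (hV.strictMonoOn (show x ∈ Ici 0 from hx) (show x + 1 ∈ Ici (0 : ℝ) from by
    rw [mem_Ici]; linarith) (by linarith)).trans_le (hV.le_one (by linarith))

theorem IsProfile.le_linear (hV : IsProfile V) {x : ℝ} (hx : 0 ≤ x) :
    V x ≤ normLinf (Ici 0) (dV V 1) * x := by
  have h := (convex_Ici (0 : ℝ)).norm_image_sub_le_of_norm_hasDerivWithin_le (f := V)
    (f' := dV V 1) (s := Ici 0) (C := normLinf (Ici 0) (dV V 1))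
    (fun y hy => by have := hV.hasDerivWithinAt_dV 0 hy; rwa [dV_zero] at this)
    (fun y hy => hV.abs_dV_le 1 hy) (show (0 : ℝ) ∈ Ici 0 by simp) (show x ∈ Ici 0 from hx)
  rw [hV.zero, sub_zero, sub_zero, Real.norm_eq_abs, Real.norm_eq_abs, abs_of_nonneg hx] at h
  exact (le_abs_self _).trans h

theorem IsProfile.ratio_le_vPlus (hV : IsProfile V) {x : ℝ} (hx : 0 ≤ x) :
    dV V 2 x ≤ vPlus V * dV V 1 x := by
  rw [← div_le_iff₀ (hV.dV_one_pos hx)]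
  exact le_ciSup hV.ratio_bddAbove (⟨x, hx⟩ : Ici (0 : ℝ))

theorem IsProfile.neg_ratio_le_vNorm (hV : IsProfile V) {x : ℝ} (hx : 0 ≤ x) :
    -dV V 2 x ≤ vNorm V * dV V 1 x := by
  have hc : ContinuousOn (fun y => dV V 2 y / dV V 1 y) (Ici 0) :=
    (hV.continuousOn_dV 2).div (hV.continuousOn_dV 1) fun y hy => (hV.dV_one_pos hy).ne'
  obtain ⟨b, hb⟩ := hV.ratio_bddBelow
  have hfin : eLpNorm (fun y => dV V 2 y / dV V 1 y) ⊤ (volume.restrict (Ici 0)) ≠ ⊤ := by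
    refine eLpNorm_top_ne_top_of_bound measurableSet_Ici (B := -b) fun y hy => ?_
    have h1 : b ≤ dV V 2 y / dV V 1 y := hb ⟨⟨y, hy⟩, rfl⟩
    rw [abs_of_neg (div_neg_of_neg_of_pos (hV.dV_two_neg hy) (hV.dV_one_pos hy))]
    linarith
  have := neg_le_of_abs_le (abs_le_normLinf_Ici hc hfin hx)
  rw [le_div_iff₀ (hV.dV_one_pos hx)] at this
  unfold vNorm
  linarith

/-- The derivatives of the rescaled profile on `(0, ∞)`. -/
noncomputable def scaledDeriv (V : ℝ → ℝ) (ε : ℝ) (k : ℕ) (x : ℝ) : ℝ := dV V k (x / ε) / ε ^ k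

theorem IsProfile.hasDerivAt_scaledDeriv (hV : IsProfile V) (hε : 0 < ε) (k : ℕ) {x : ℝ}
    (hx : 0 < x) : HasDerivAt (scaledDeriv V ε k) (scaledDeriv V ε (k + 1) x) x := by
  have h1 := hV.hasDerivAt_dV k (div_pos hx hε)
  have h2 : HasDerivAt (fun x : ℝ => x / ε) (1 / ε) x := (hasDerivAt_id x).div_const ε
  have h3 := (HasDerivAt.comp (h₂ := dV V k) (h := fun x : ℝ => x / ε) x h1 h2).div_const (ε ^ k)
  have e : scaledDeriv V ε (k + 1) x = dV V (k + 1) (x / ε) * (1 / ε) / ε ^ k := by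
    unfold scaledDeriv
    rw [pow_succ']; field_simp
  rw [e]
  exact h3

theorem scaledDeriv_zero : scaledDeriv V ε 0 = scaled V ε := by
  ext x; simp [scaledDeriv, scaled, dV_zero]

theorem IsProfile.isFlux (hV : IsProfile V) (hε : 0 < ε) :
    IsFlux (scaled V ε) (scaledDeriv V ε 1) (scaledDeriv V ε 2) (scaledDeriv V ε 3)
      (normLinf (Ici 0) (dV V 1) / ε) (vNorm V / ε) := by
  have hd : ∀ y : ℝ, 0 < y → 0 ≤ y / ε := fun y hy => (div_pos hy hε).le
  constructor
  · intro y hy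
    rw [← scaledDeriv_zero]
    exact hV.hasDerivAt_scaledDeriv hε 0 hy
  · exact fun y hy => hV.hasDerivAt_scaledDeriv hε 1 hy
  · exact fun y hy => hV.hasDerivAt_scaledDeriv hε 2 hy
  · exact fun y hy => hV.pos _ (div_pos hy hε)
  · exact fun y hy => hV.le_one (hd y hy)
  · exact fun y hy => div_pos (hV.dV_one_pos (hd y hy)) (by positivity)
  · exact fun y hy => div_neg_of_neg_of_pos (hV.dV_two_neg (hd y hy)) (by positivity)
  · exact fun y hy => div_pos (hV.dV_three_pos (hd y hy)) (by positivity)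
  · intro y hy
    unfold scaledDeriv
    rw [pow_one]
    exact div_le_div_of_nonneg_right ((le_abs_self _).trans (hV.abs_dV_le 1 (hd y hy))) hε.le
  · intro y hy
    unfold scaled
    rw [div_mul_eq_mul_div, ← mul_div_assoc']
    exact hV.le_linear (hd y hy)
  · intro y hy
    unfold scaledDeriv
    have := div_le_div_of_nonneg_right (hV.neg_ratio_le_vNorm (hd y hy)) (sq_nonneg ε)
    calc _ = -dV V 2 (y / ε) / ε ^ 2 := by ring
      _ ≤ _ := this
      _ = _ := by field_simp

theorem IsProfile.scaledDeriv_two_le (hV : IsProfile V) (hε : 0 < ε) {y : ℝ} (hy : 0 < y) :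
    scaledDeriv V ε 2 y ≤ -(-vPlus V / ε) * scaledDeriv V ε 1 y := by
  unfold scaledDeriv
  have := div_le_div_of_nonneg_right (hV.ratio_le_vPlus (div_pos hy hε).le) (sq_nonneg ε)
  calc _ ≤ _ := this
    _ = _ := by field_simp

/-- The assumption `slope_bdd` makes the supremum over `ε` genuine, and continuity turns the
essential bound for each `ε` into a pointwise one. -/
theorem IsProfile.scaledDeriv_one_le_supSlope (hV : IsProfile V) (hε : 0 < ε) {c x : ℝ}
    (hc : 0 < c) (hx : c ≤ x) : scaledDeriv V ε 1 x ≤ supSlope V c := by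
  have he : ∀ y, 0 < y → dV (scaled V ε) 1 y = scaledDeriv V ε 1 y := fun y hy => by
    have h := (hV.isFlux hε).d0 y hy
    unfold dV
    rw [iteratedDerivWithin_one]
    exact (h.hasDerivWithinAt (s := Ici 0)).derivWithin (uniqueDiffOn_Ici 0 y hy.le)
  have hcont : ContinuousOn (dV (scaled V ε) 1) (Ici c) := by
    refine ContinuousOn.congr (f := scaledDeriv V ε 1) (fun y hy => ?_)
      fun y hy => he y (hc.trans_le hy)
    exact (hV.hasDerivAt_scaledDeriv hε 1 (hc.trans_le hy)).continuousAt.continuousWithinAt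
  have hfin : eLpNorm (dV (scaled V ε) 1) ⊤ (volume.restrict (Ici c)) ≠ ⊤ := by
    refine eLpNorm_top_ne_top_of_bound measurableSet_Ici
      (B := normLinf (Ici 0) (dV V 1) / ε) fun y hy => ?_
    have hy0 : 0 < y := hc.trans_le hy
    rw [he y hy0, abs_of_pos ((hV.isFlux hε).pos1 y hy0)]
    exact (hV.isFlux hε).le_slope y hy0
  have h1 := (le_abs_self _).trans (abs_le_normLinf_Ici hcont hfin hx)
  rw [he x (hc.trans_le hx)] at h1
  exact h1.trans (le_ciSup (hV.slope_bdd c hc) (⟨ε, hε⟩ : Ioi (0 : ℝ)))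

theorem IsProfile.scaledDeriv_one_anti (hV : IsProfile V) (hε : 0 < ε) {x y : ℝ} (hx : 0 < x)
    (hxy : x ≤ y) : scaledDeriv V ε 1 y ≤ scaledDeriv V ε 1 x := by
  have h : AntitoneOn (scaledDeriv V ε 1) (Ioi 0) := by
    refine antitoneOn_of_deriv_nonpos (convex_Ioi 0) (fun y hy =>
      (hV.hasDerivAt_scaledDeriv hε 1 hy).continuousAt.continuousWithinAt) (fun y hy => ?_)
      fun y hy => ?_
    · rw [interior_Ioi] at hy
      exact (hV.hasDerivAt_scaledDeriv hε 1 hy).differentiableAt.differentiableWithinAt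
    · rw [interior_Ioi] at hy
      rw [(hV.hasDerivAt_scaledDeriv hε 1 hy).deriv]
      exact ((hV.isFlux hε).neg2 y hy).le
  exact h hx (hx.trans_le hxy) hxy

theorem IsProfile.scaled_mono (hV : IsProfile V) (hε : 0 < ε) {x y : ℝ} (hx : 0 ≤ x)
    (hxy : x ≤ y) : scaled V ε x ≤ scaled V ε y :=
  hV.strictMonoOn.monotoneOn (show x / ε ∈ Ici 0 from div_nonneg hx hε.le)
    (show y / ε ∈ Ici 0 from div_nonneg (hx.trans hxy) hε.le)
    (div_le_div_of_nonneg_right hxy hε.le)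

end Profile

theorem eventually_lt_of_hasDerivAt_neg {f : ℝ → ℝ} {f' : ℝ} (hf : HasDerivAt f f' 0)
    (h : f' < 0) : ∀ᶠ x in 𝓝[>] 0, f x < f 0 := by
  have ht := (hasDerivWithinAt_iff_tendsto_slope' (by simp)).1
    (hf.hasDerivWithinAt (s := Ioi 0))
  filter_upwards [ht.eventually_lt_const h, self_mem_nhdsWithin] with y hy hy0
  rw [slope_def_field, sub_zero] at hy
  have hy0' : 0 < y := hy0
  have := (div_lt_iff₀ hy0').1 hy
  linarith

/-! ### Consequences of the assumptions on obstacle and datum -/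

section Data

variable {o q₀ : ℝ → ℝ}

theorem IsData.ae_cZero_le (hd : IsData o q₀) : ∀ᵐ x, cZero o q₀ ≤ o x - q₀ x := by
  refine ae_essInf_le ?_
  -- Without an essential lower bound, `essInf` takes the default value `sSup ∅ = 0`, which
  -- positivity of the gap excludes.
  by_contra hb
  have h0 : essInf (fun x => o x - q₀ x) volume = 0 := by
    have he : {b | ∀ᵐ x, b ≤ o x - q₀ x} = ∅ :=
      eq_empty_iff_forall_notMem.2 fun b hb' => hb ⟨b, eventually_map.2 hb'⟩
    rw [essInf, Filter.liminf_eq, he]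
    exact Real.sSup_empty
  exact hd.gap.ne' h0

theorem IsData.cZero_le (hd : IsData o q₀) (x : ℝ) : cZero o q₀ ≤ o x := by
  have h : ∀ᵐ x, cZero o q₀ ≤ o x := by
    filter_upwards [hd.ae_cZero_le, hd.init_nonneg] with x h1 h2
    linarith
  have hcl : IsClosed {x | cZero o q₀ ≤ o x} := isClosed_le continuous_const hd.obst_continuous
  have := Measure.dense_of_ae h x
  rwa [hcl.closure_eq] at this

theorem IsData.bddBelow (hd : IsData o q₀) : BddBelow (range o) :=
  ⟨cZero o q₀, by rintro _ ⟨x, rfl⟩; exact hd.cZero_le x⟩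

theorem IsData.cZero_le_iInf (hd : IsData o q₀) : cZero o q₀ ≤ ⨅ y, o y :=
  le_ciInf hd.cZero_le

variable {o1 : ℝ → ℝ} {N1 : ℝ}

/-- Finiteness of the slopes, so that `oslUpper` and `oslLower` are true bounds and not default
values. -/
theorem IsData.exists_slope_le (hd : IsData o q₀) (ho : ∀ x, HasDerivAt o (o1 x) x)
    (hN1 : ∀ x, |o1 x| ≤ N1) :
    ∃ L, ∀ p : {p : ℝ × ℝ // p.1 ≠ p.2},
      ((o p.1.1 - q₀ p.1.1) - (o p.1.2 - q₀ p.1.2)) / (p.1.1 - p.1.2) ≤ L := by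
  obtain ⟨C, hC⟩ := hd.init_osl
  refine ⟨N1 - C, fun p => ?_⟩
  have h1 := hC _ _ p.2
  have h2 : (o p.1.1 - o p.1.2) / (p.1.1 - p.1.2) ≤ N1 := by
    refine (le_abs_self _).trans ?_
    rw [abs_div, div_le_iff₀ (abs_pos.2 (sub_ne_zero.2 p.2))]
    exact abs_sub_sub_le ho hN1 _ _
  have h3 : ((o p.1.1 - q₀ p.1.1) - (o p.1.2 - q₀ p.1.2)) / (p.1.1 - p.1.2) =
    (o p.1.1 - o p.1.2) / (p.1.1 - p.1.2) - (q₀ p.1.1 - q₀ p.1.2) / (p.1.1 - p.1.2) := by ring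
  linarith

theorem IsData.increment_le (hd : IsData o q₀) (ho : ∀ x, HasDerivAt o (o1 x) x)
    (hN1 : ∀ x, |o1 x| ≤ N1) (x y : ℝ) (hxy : x < y) :
    (o y - q₀ y) - (o x - q₀ x) ≤ oslUpper (fun y => o y - q₀ y) * (y - x) := by
  obtain ⟨L, hL⟩ := hd.exists_slope_le ho hN1
  have h := le_ciSup (f := fun p : {p : ℝ × ℝ // p.1 ≠ p.2} =>
      ((o p.1.1 - q₀ p.1.1) - (o p.1.2 - q₀ p.1.2)) / (p.1.1 - p.1.2))
    ⟨L, by rintro _ ⟨p, rfl⟩; exact hL p⟩ ⟨(y, x), hxy.ne'⟩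
  exact (div_le_iff₀ (sub_pos.2 hxy)).1 h

theorem IsData.oslUpper_le_neg_oslLower (hd : IsData o q₀) (ho : ∀ x, HasDerivAt o (o1 x) x)
    (hN1 : ∀ x, |o1 x| ≤ N1) :
    oslUpper (fun y => o y - q₀ y) ≤ -oslLower (fun y => q₀ y - o y) := by
  obtain ⟨L, hL⟩ := hd.exists_slope_le ho hN1
  have e : ∀ p : {p : ℝ × ℝ // p.1 ≠ p.2},
      ((q₀ p.1.1 - o p.1.1) - (q₀ p.1.2 - o p.1.2)) / (p.1.1 - p.1.2) =
      -(((o p.1.1 - q₀ p.1.1) - (o p.1.2 - q₀ p.1.2)) / (p.1.1 - p.1.2)) := fun p => by ring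
  have : Nonempty {p : ℝ × ℝ // p.1 ≠ p.2} := ⟨⟨(0, 1), zero_ne_one⟩⟩
  refine ciSup_le fun p => ?_
  have h := ciInf_le (f := fun p : {p : ℝ × ℝ // p.1 ≠ p.2} =>
      ((q₀ p.1.1 - o p.1.1) - (q₀ p.1.2 - o p.1.2)) / (p.1.1 - p.1.2))
    ⟨-L, by rintro _ ⟨p, rfl⟩; simp only [e]; linarith [hL p]⟩ p
  rw [e] at h
  unfold oslLower
  linarith

end Data

/-! ### Choice of the viscosity threshold and assembly -/

/-- The larger root of `a W² + 2 b W = c` for `a < 0`, in the form of the constant `C₁`. -/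
theorem lt_quadratic_of_root_lt {P b N c W : ℝ} (hP : P < 0)
    (hW : √(b ^ 2 * N ^ 2 / P ^ 2 + 2 * c / P) - b * N / P < W) :
    0 < -P / 2 * W ^ 2 - b * N * W + c := by
  have hP0 : P ≠ 0 := hP.ne
  have h1 : √(b ^ 2 * N ^ 2 / P ^ 2 + 2 * c / P) < W + b * N / P := by linarith
  have h2 : b ^ 2 * N ^ 2 / P ^ 2 + 2 * c / P < (W + b * N / P) ^ 2 :=
    (Real.sqrt_lt' ((Real.sqrt_nonneg _).trans_lt h1)).1 h1
  have h3 := mul_lt_mul_of_pos_left h2 (show 0 < -P / 2 by linarith)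
  have e1 : -P / 2 * (b ^ 2 * N ^ 2 / P ^ 2 + 2 * c / P) = -(b ^ 2 * N ^ 2 / P) / 2 - c := by
    field_simp
    ring
  have e2 : -P / 2 * (W + b * N / P) ^ 2 =
      -P / 2 * W ^ 2 - b * N * W - (b ^ 2 * N ^ 2 / P) / 2 := by
    field_simp
    ring
  rw [e1, e2] at h3
  linarith

theorem root_pos {P b N c : ℝ} (hP : P < 0) (hb : 0 ≤ b) (hN : 0 ≤ N) (hc : c < 0) :
    0 < √(b ^ 2 * N ^ 2 / P ^ 2 + 2 * c / P) - b * N / P := by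
  have h1 : 0 < 2 * c / P := div_pos_of_neg_of_neg (by linarith) hP
  have h2 : b * N / P ≤ 0 := div_nonpos_of_nonneg_of_nonpos (by positivity) hP.le
  have h3 : 0 < √(b ^ 2 * N ^ 2 / P ^ 2 + 2 * c / P) := Real.sqrt_pos.2 (by positivity)
  linarith

/-- For small `ν` the initial flux slope obeys the bound. -/
theorem eventually_initial_flux_slope_le {f1 f2 : ℝ → ℝ} {g κ c a N2 K3 M : ℝ}
    (hd1 : ∀ y, 0 < y → HasDerivAt f1 (f2 y) y) (hpos : ∀ y, 0 < y → 0 < f1 y)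
    (hneg : ∀ y, 0 < y → f2 y < 0) (hanti : ∀ x y, 0 < x → x ≤ y → f1 y ≤ f1 x)
    (hg : ∀ y, 0 < y → f1 y ≤ g) (hκ : 0 < κ) (hc : 0 < c) (hM : 0 < M)
    (haM : a * f1 c ≤ M) :
    ∀ᶠ ν in 𝓝[>] (0 : ℝ), ∀ u z, 0 < u → z ≤ a + N2 * ν →
      (0 ≤ a → (z ≤ a + K3 * ν ^ 2 ∧ c + κ * a * ν / 32 - N2 * ν ^ 2 ≤ u) ∨
        (z ≤ a - κ * a / 16 + K3 * ν ^ 2 ∧ c - N2 * ν ^ 2 ≤ u)) → f1 u * z ≤ M := by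
  have hcont1 : ContinuousAt f1 c := (hd1 c hc).continuousAt
  have tend : ∀ (f : ℝ → ℝ), ContinuousAt f 0 → ∀ b, f 0 < b → ∀ᶠ ν in 𝓝[>] (0 : ℝ), f ν < b :=
    fun f hf b hb => (hf.tendsto.mono_left nhdsWithin_le_nhds).eventually_lt_const hb
  -- For `a ≤ 0` the slope is at most `N2 ν`, so positivity of `M` suffices; the dichotomy is needed
  -- only for `a > 0`.
  rcases le_or_gt a 0 with ha | ha
  · filter_upwards [tend (fun ν => g * (N2 * ν)) (by fun_prop) M (by simpa using hM),
      self_mem_nhdsWithin] with ν h1 hν u z hu hz _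
    have hν0 : 0 < ν := hν
    rcases le_or_gt z 0 with hz0 | hz0
    · exact (mul_nonpos_of_nonneg_of_nonpos (hpos u hu).le hz0).trans hM.le
    · exact (mul_le_mul (hg u hu) (by linarith) hz0.le
        ((hpos u hu).le.trans (hg u hu))).trans h1.le
  -- In the first alternative the bound equals `f1 c * a` at `ν = 0` and has negative derivative
  -- there: the decrease of `f1` acts at first order, while `N2` and `K3` enter only at second
  -- order.
  · have hψ : HasDerivAt (fun ν => f1 (c + κ * a * ν / 32 - N2 * ν ^ 2) * (a + K3 * ν ^ 2))
        (f2 c * (κ * a / 32) * a) 0 := by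
      have i1 : HasDerivAt (fun ν : ℝ => c + κ * a * ν / 32 - N2 * ν ^ 2) (κ * a / 32) 0 := by
        have := ((((hasDerivAt_id (0 : ℝ)).const_mul (κ * a)).div_const 32).const_add c).sub
          (((hasDerivAt_id (0 : ℝ)).pow 2).const_mul N2)
        refine (this.congr_deriv ?_)
        simp
      have i2 : HasDerivAt (fun ν : ℝ => a + K3 * ν ^ 2) 0 0 := by
        have := (((hasDerivAt_id (0 : ℝ)).pow 2).const_mul K3).const_add a
        refine (this.congr_deriv ?_)
        simp
      have e0 : c + κ * a * 0 / 32 - N2 * 0 ^ 2 = c := by ring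
      have i3 := HasDerivAt.comp (h₂ := f1) (h := fun ν : ℝ => c + κ * a * ν / 32 - N2 * ν ^ 2)
        (0 : ℝ) (by simp only [e0]; exact hd1 c hc) i1
      refine (i3.mul i2).congr_deriv ?_
      simp
    have l1 := eventually_lt_of_hasDerivAt_neg hψ
      (mul_neg_of_neg_of_pos (mul_neg_of_neg_of_pos (hneg c hc) (by positivity)) ha)
    -- In the second alternative the limit as `ν → 0` is already strictly below `f1 c * a`.
    have l2 := tend (fun ν => f1 (c - N2 * ν ^ 2) * (a - κ * a / 16 + K3 * ν ^ 2))
      (by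
        have : ContinuousAt (fun ν : ℝ => f1 (c - N2 * ν ^ 2)) 0 := by
          refine ContinuousAt.comp (g := f1) (f := fun ν : ℝ => c - N2 * ν ^ 2) ?_ (by fun_prop)
          simpa using hcont1
        exact this.mul (by fun_prop)) (f1 c * a)
      (by
        have : 0 < κ * a / 16 := by positivity
        simp only [ne_eq, OfNat.ofNat_ne_zero, not_false_eq_true, zero_pow, mul_zero, sub_zero,
          add_zero]
        exact mul_lt_mul_of_pos_left (by linarith) (hpos c hc))
    have l3 := tend (fun ν => N2 * ν ^ 2) (by fun_prop) c (by simpa using hc)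
    filter_upwards [l1, l2, l3, self_mem_nhdsWithin] with ν h1 h2 h3 hν u z hu _ hz
    have hν0 : 0 < ν := hν
    rcases le_or_gt z 0 with hz0 | hz0
    · exact (mul_nonpos_of_nonneg_of_nonpos (hpos u hu).le hz0).trans hM.le
    · have h4 : 0 < κ * a * ν / 32 := by positivity
      have h1' : f1 (c + κ * a * ν / 32 - N2 * ν ^ 2) * (a + K3 * ν ^ 2) < f1 c * a := by
        simpa using h1
      rcases hz ha.le with ⟨k1, k2⟩ | ⟨k1, k2⟩
      · have hp : 0 < c + κ * a * ν / 32 - N2 * ν ^ 2 := by linarith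
        have := mul_le_mul (hanti _ _ hp k2) k1 hz0.le (hpos _ hp).le
        linarith
      · have hp : 0 < c - N2 * ν ^ 2 := by linarith
        have := mul_le_mul (hanti _ _ hp k2) k1 hz0.le (hpos _ hp).le
        linarith

/-- The right-hand side of the one-sided Lipschitz bound. -/
noncomputable def oslBound (T : ℝ) (V o q₀ : ℝ → ℝ) : ℝ :=
  max (constOne V o) (max (constTwo T o q₀ * supSlope V (kZero o))
    (oslUpper (fun y => o y - q₀ y) * supSlope V (cZero o q₀)))

/-- For fixed `ε`, finitely many smallness conditions on `ν`, none involving `q`, make all the a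
priori estimates applicable. -/
theorem eventually_osl {T : ℝ} (hT : 0 < T) {V : ℝ → ℝ} (hV : IsProfile V) {o q₀ : ℝ → ℝ}
    (hdata : IsData o q₀) {ε : ℝ} (hε : 0 < ε) :
    ∀ᶠ ν in 𝓝[>] (0 : ℝ), ∀ q : ℝ → ℝ → ℝ, IsViscosityApprox V o q₀ T ν ε q →
      ∀ t ∈ Ioo 0 T, ∀ x : ℝ,
        DifferentiableAt ℝ (fun y => scaled V ε (o y - q t y)) x ∧
        deriv (fun y => scaled V ε (o y - q t y)) x ≤ oslBound T V o q₀ := by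
  obtain ⟨o1, o2, o3, ho, ho1, ho2, -, ⟨B, hB⟩, hN1, hN2, K3, hK3⟩ :=
    exists_derivs_of_memW hdata.obst_continuous hdata.obst_sobolev
  set N1 := normLinf univ (deriv o) with hN1d
  set N2 := normLinf univ (iteratedDeriv 2 o) with hN2d
  set G := normLinf (Ici 0) (dV V 1) with hGd
  set c := cZero o q₀ with hcd
  set a := oslUpper (fun y => o y - q₀ y) with had
  set Z := constTwo T o q₀ with hZd
  set M := oslBound T V o q₀ with hMd
  set κ := bump (1 / 2) / ∫ y, bump y with hκd
  have hN1' : 0 ≤ N1 := normLinf_nonneg _ _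
  have hN2' : 0 ≤ N2 := normLinf_nonneg _ _
  have hκ : 0 < κ := div_pos bump_half_pos integral_bump_pos
  have hc : 0 < c := hdata.gap
  have hF := hV.isFlux hε
  have hG : 0 < G := (hV.dV_one_pos le_rfl).trans_le ((le_abs_self _).trans (hV.abs_dV_le 1 le_rfl))
  have hv : 0 ≤ vNorm V := normLinf_nonneg _ _
  have hB0 : 0 ≤ B := (abs_nonneg _).trans (hB 0)
  have hI : c ≤ ⨅ y, o y := hdata.cZero_le_iInf
  have hk : 0 < kZero o := by unfold kZero; linarith
  have hP : vPlus V * (⨅ y, o y) < 0 := mul_neg_of_neg_of_pos hV.ratio_neg (by linarith)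
  have hC1 : 0 < constOne V o :=
    root_pos (b := vNorm V + 2 * G) (c := G * (-N2 - 1)) hP (by positivity) hN1'
      (by nlinarith) |>.trans_eq (by
      unfold constOne; rw [mul_assoc 2 G])
  have hM : 0 < M := hC1.trans_le (le_max_left _ _)
  have haM : a * scaledDeriv V ε 1 c ≤ M := by
    rcases le_or_gt a 0 with h | h
    · exact (mul_nonpos_of_nonpos_of_nonneg h (hF.pos1 c hc).le).trans hM.le
    · exact (mul_le_mul_of_nonneg_left (hV.scaledDeriv_one_le_supSlope hε hc le_rfl) h.le).trans
        ((le_max_right _ _).trans (le_max_right _ _))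
  have haZ : max (2 * N1) a + T * N2 ≤ Z := by
    have h1 := hdata.oslUpper_le_neg_oslLower ho hN1
    have h2 : max (2 * N1) a ≤ -min (-2 * N1) (oslLower fun y => q₀ y - o y) := by
      refine max_le ?_ ?_
      · linarith [min_le_left (-2 * N1) (oslLower fun y => q₀ y - o y)]
      · linarith [min_le_right (-2 * N1) (oslLower fun y => q₀ y - o y)]
    rw [hZd, constTwo]
    linarith
  have hZ0 : 0 ≤ Z := by
    have : 0 ≤ max (2 * N1) a := le_max_of_le_left (by positivity)
    have : 0 ≤ T * N2 := by positivity
    linarith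
  -- As `u ≤ B + 1`, the velocity stays below `σ < 1`. The slope then grows at rate `σ N2` instead
  -- of `N2`, and the slack `(1 - σ) T N2` absorbs the mollification error `N2 ν`.
  set σ := scaled V ε (B + 1) with hσd
  have hσ1 : σ < 1 := hV.lt_one (by positivity)
  have hσ0 : 0 ≤ σ := (hF.pos0 _ (by linarith)).le
  set E := Real.exp ((G / ε * N1 + N2 + 1) * T) with hE
  have hE0 : 0 < E := Real.exp_pos _
  have tend : ∀ (f : ℝ → ℝ), ContinuousAt f 0 → ∀ b, f 0 < b → ∀ᶠ ν in 𝓝[>] (0 : ℝ), f ν < b :=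
    fun f hf b hb => (hf.tendsto.mono_left nhdsWithin_le_nhds).eventually_lt_const hb
  -- In order, the conditions after positivity give `u ≥ c / 2` initially, `q > -1`, the condition
  -- `κ v ≤ 1` of `IsFlow.slope_le`, the slack just described, the viscous remainder bound, and the
  -- initial bound on `w`.
  filter_upwards [self_mem_nhdsWithin,
    tend (fun ν => N1 * ν) (by fun_prop) (c / 2) (by simpa using hc),
    tend (fun ν => ν * E) (by fun_prop) 1 (by simp),
    tend (fun ν => ν * E * (vNorm V / ε)) (by fun_prop) 1 (by simp),
    tend (fun ν => ν) (by fun_prop) ((1 - σ) * T) (mul_pos (by linarith) hT),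
    tend (fun ν => 2 * ν * (vNorm V / ε) ^ 2 * Z ^ 3) (by fun_prop) 1 (by simp),
    eventually_initial_flux_slope_le (K3 := K3) hF.d1 hF.pos1 hF.neg2
      (fun x y => hV.scaledDeriv_one_anti hε) hF.le_slope hκ hc hM haM]
    with ν hν' s1 s2 s3 s4 s5 s6 q hq
  have hν : 0 < ν := hν'
  obtain ⟨z, zx, zxx, ut, zt, hflow⟩ := hq.exists_isFlow hT hF.d0 ho ho1 ho2
  have hker := isKernel_mollifier hν
  have hincr := hdata.increment_le ho hN1
  have h0T : (0 : ℝ) ∈ Ico 0 T := ⟨le_rfl, hT⟩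
  have hu0 : (fun x => o x - q 0 x) = initDist (mollifier ν) o q₀ := by
    ext x
    rw [hq.initial, mollify_eq, initDist]
  have hz0 : ∀ x, HasDerivAt (initDist (mollifier ν) o q₀) (z 0 x) x := fun x => by
    rw [← hu0]; exact hflow.d_u 0 h0T x
  have hpos : ∀ t ∈ Ico 0 T, ∀ x, 0 < o x - q t x := by
    refine hflow.pos (m := c / 2) (m' := c) hF hν.le hN1 (by linarith) (by linarith)
      hdata.cZero_le fun x => ?_
    have h1 := le_initDist hker hdata.init_integrable ho hB hN1 hdata.ae_cZero_le x
    have h2 : o x - q 0 x = initDist (mollifier ν) o q₀ x := congrFun hu0 x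
    rw [h2]
    linarith
  have hlow : ∀ t ∈ Ico 0 T, ∀ x, o x - q t x - o x ≤ ν * E := by
    refine hflow.lower hF hν ho ho1 hN1 hN2 hpos (fun x => ?_)
    have : 0 ≤ q 0 x := by
      rw [hq.initial]
      refine integral_nonneg_of_ae ?_
      filter_upwards [hdata.init_nonneg] with y hy
      exact mul_nonneg (hker.nonneg _) hy
    linarith
  have hdz : ∀ x, z 0 x ≤ a + N2 * ν := fun x =>
    deriv_initDist_le hker hdata.init_integrable ho ho1 hB hN2 hincr (hz0 x)
  have hslope : ∀ t ∈ Ico 0 T, ∀ x, z t x ≤ Z := by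
    intro t ht x
    have h1 := hflow.slope_le (A := max (2 * N1) a + N2 * ν) (κ := ν * E) (σ := σ) hF hν.le ho ho1
      hN1 hN2 hpos hlow (by positivity) s3.le
      (fun t ht x => hV.scaled_mono hε (hpos t ht x).le (by
        have := hlow t ht x
        have := (abs_le.1 (hB x)).2
        linarith)) hσ0
      (by have := le_max_left (2 * N1) a; have : 0 ≤ N2 * ν := by positivity
          linarith)
      (fun x => by have := le_max_right (2 * N1) a; linarith [hdz x]) t ht x
    have h2 : σ * N2 * t ≤ σ * N2 * T := mul_le_mul_of_nonneg_left ht.2.le (by positivity)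
    have h3 : N2 * ν ≤ N2 * ((1 - σ) * T) := mul_le_mul_of_nonneg_left s4.le hN2'
    linarith [show N2 * ((1 - σ) * T) + σ * N2 * T = T * N2 by ring]
  have hmain := hflow.flux_slope_le (M := M) (Z := Z) (k := kZero o) (α := -vPlus V / ε)
    hF hν.le ho ho1 hN1 hN2 hpos hslope hM.le hk
    (fun x => by
      have := ciInf_le hdata.bddBelow x
      unfold kZero
      linarith)
    (fun t ht x hku => by
      rcases le_or_gt (z t x) 0 with h | h
      · exact (mul_nonpos_of_nonneg_of_nonpos (hF.pos1 _ (hpos t ht x)).le h).trans hM.le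
      · refine le_trans ?_ ((le_max_left _ _).trans (le_max_right _ _))
        rw [mul_comm]
        exact mul_le_mul (hslope t ht x) (hV.scaledDeriv_one_le_supSlope hε hk hku)
          (hF.pos1 _ (hpos t ht x)).le hZ0)
    (div_nonneg (by linarith [hV.ratio_neg]) hε.le)
    (fun y hy => hV.scaledDeriv_two_le hε hy) s5.le
    -- Since `α`, `g` and `v` all scale like `1/ε`, the quadratic is `1/ε` times the `ε`-independent
    -- one whose larger root is `C₁`.
    (fun W hW => by
      have h1 := lt_quadratic_of_root_lt (P := vPlus V * (⨅ y, o y)) (b := vNorm V + 2 * G)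
        (N := N1) (c := G * (-N2 - 1)) (W := W) hP
        (((le_max_left _ _).trans_lt hW).trans_eq' (by unfold constOne; rw [mul_assoc 2 G]))
      have h2 := div_pos h1 hε
      refine h2.trans_eq ?_
      unfold kZero
      field_simp
      ring)
    (fun x => by
      have hx : o x - q 0 x = initDist (mollifier ν) o q₀ x := congrFun hu0 x
      refine s6 _ _ (hpos 0 h0T x) (hdz x) fun ha0 => ?_
      rw [hx]
      exact initDist_dichotomy hker hν hκ.le hdata.init_integrable ho ho1 ho2 hB hN2 hK3
        hdata.ae_cZero_le ha0 hincr (hz0 x))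
  intro t ht x
  have ht' : t ∈ Ico 0 T := ⟨ht.1.le, ht.2⟩
  have hd : HasDerivAt (fun y => scaled V ε (o y - q t y))
      (scaledDeriv V ε 1 (o x - q t x) * z t x) x :=
    HasDerivAt.comp (h₂ := scaled V ε) (h := fun y => o y - q t y) x (hF.d0 _ (hpos t ht' x))
      (hflow.d_u t ht' x)
  exact ⟨hd.differentiableAt, hd.deriv ▸ hmain t ht' x⟩

end Obstacle

theorem mainTheorem6 (T : ℝ) (hT : 0 < T) (V : ℝ → ℝ) (hV : Obstacle.IsProfile V)
    (o q₀ : ℝ → ℝ) (hdata : Obstacle.IsData o q₀) :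
    ∃ νbar : ℝ → ℝ, (∀ ε, 0 < ε → 0 < νbar ε) ∧ Tendsto νbar (𝓝[>] 0) (𝓝 0) ∧
      ∀ ε, 0 < ε → ∀ ν, 0 < ν → ν ≤ νbar ε →
        ∀ q : ℝ → ℝ → ℝ, Obstacle.IsViscosityApprox V o q₀ T ν ε q →
          ∀ t ∈ Ioo 0 T, ∀ x : ℝ,
            DifferentiableAt ℝ (fun y => Obstacle.scaled V ε (o y - q t y)) x ∧
            deriv (fun y => Obstacle.scaled V ε (o y - q t y)) x ≤
              max (Obstacle.constOne V o)
                (max (Obstacle.constTwo T o q₀ * Obstacle.supSlope V (Obstacle.kZero o))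
                  (Obstacle.oslUpper (fun y => o y - q₀ y)
                    * Obstacle.supSlope V (Obstacle.cZero o q₀))) := by
  have key : ∀ ε : ℝ, ∃ b : ℝ, 0 < b ∧ (0 < ε → ∀ ν, 0 < ν → ν ≤ b →
      ∀ q : ℝ → ℝ → ℝ, Obstacle.IsViscosityApprox V o q₀ T ν ε q →
        ∀ t ∈ Ioo 0 T, ∀ x : ℝ,
          DifferentiableAt ℝ (fun y => Obstacle.scaled V ε (o y - q t y)) x ∧
          deriv (fun y => Obstacle.scaled V ε (o y - q t y)) x ≤ Obstacle.oslBound T V o q₀) := by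
    intro ε
    by_cases hε : 0 < ε
    · obtain ⟨b, hb, hb'⟩ :=
        mem_nhdsGT_iff_exists_Ioc_subset.1 (Obstacle.eventually_osl hT hV hdata hε)
      exact ⟨b, hb, fun _ ν h1 h2 => hb' ⟨h1, h2⟩⟩
    · exact ⟨1, one_pos, fun h => absurd h hε⟩
  choose b hb hb' using key
  -- The minimum with `ε` serves only to make the threshold tend to zero.
  refine ⟨fun ε => min (b ε) ε, fun ε hε => lt_min (hb ε) hε, ?_,
    fun ε hε ν h1 h2 => hb' ε hε ν h1 (h2.trans (min_le_left _ _))⟩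
  refine tendsto_of_tendsto_of_tendsto_of_le_of_le' tendsto_const_nhds
    (tendsto_id.mono_left nhdsWithin_le_nhds) ?_ ?_
  · filter_upwards [self_mem_nhdsWithin] with ε hε using (lt_min (hb ε) hε).le
  · exact Eventually.of_forall fun ε => min_le_right _ _
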